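/- Let $J^2=J^2(\mathbb R^2,\mathbb R)=\mathbb R^8$ with coordinates $(x,y,z,p,q,r,s,t)$ and 1-forms $$\varpi_0=dz-p\,dx-q\,dy,\qquad \varpi_1=dp-r\,dx-s\,dy,\qquad \varpi_2=dq-s\,dx-t\,dy .$$ Let $F:J^2\to\mathbb R$ be a $C^\infty$ function such that $(F_r,F_s,F_t)\neq(0,0,0)$ at every point of $R=\{F=0\}$ (a regular second-order PDE), and let $D=\{\varpi_0|_R=\varpi_1|_R=\varpi_2|_R=0\}\subset TR$. With $\Delta=F_rF_t-F_s^2/4$, a point $w\in R$ is called hyperbolic if $\Delta(w)<0$, elliptic if $\Delta(w)>0$, and parabolic if $(F_r,F_s,F_t)_w\ne(0,0,0)$ and $\Delta(w)=0$. A 2-dimensional integral element of $(R,D)$ at $w$ is a 2-dimensional subspace $v\subset T_wR$ with $\varpi_i|_v=0$ and $d\varpi_i|_v=0$ for $i=0,1,2$. The rank 2 prolongation $\Sigma(R)$ is the set of all pairs $(w,v)$ with $w\in R$ and $v$ a 2-dimensional integral element at $w$, with the topology induced from the Grassmann bundle of 2-planes, and $p:\Sigma(R)\to R$ is the projection $(w,v)\mapsto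 w$. The pinched 2-torus is the quotient space of $S^1\times S^1$ obtained by collapsing one circle $\{1\}\times S^1$ to a point. Then for every $w\in R$: 1. $w$ is hyperbolic if and only if $p^{-1}(w)$ is homeomorphic to the torus $T^2=S^1\times S^1$; 2. $w$ is parabolic if and only if $p^{-1}(w)$ is homeomorphic to the pinched 2-torus; 3. $w$ is elliptic if and only if $p^{-1}(w)$ is homeomorphic to the sphere $S^2$. Moreover $\dim D(w)=4$, and $p^{-1}(w)$ is the subset of $\mathrm{Gr}(2,D(w))\cong \mathrm{Gr}(2,4)$ consisting of the 2-planes $v\subset D(w)$ with $d\varpi_1|_v=d\varpi_2|_v=0$. -/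

import Mathlib

open scoped ContDiff

noncomputable section

namespace SecondOrderPDE

/-- The `2`-jet space `J²(ℝ², ℝ)`, with coordinates
`(x, y, z, p, q, r, s, t)` numbered `0, 1, 2, 3, 4, 5, 6, 7`. -/
abbrev Jet2 : Type := Fin 8 → ℝ

/-- The coordinate differential `d(w i)` on `Jet2`. -/
abbrev dcoord (i : Fin 8) : Jet2 →L[ℝ] ℝ := ContinuousLinearMap.proj i

/-- The three generators of the canonical system on `Jet2`, as covectors at `w`:
`dz - p dx - q dy`, `dp - r dx - s dy`, `dq - s dx - t dy`. -/
def contactCovector : Fin 3 → Jet2 → (Jet2 →L[ℝ] ℝ)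
  | 0, w => dcoord 2 - w 3 • dcoord 0 - w 4 • dcoord 1
  | 1, w => dcoord 3 - w 5 • dcoord 0 - w 6 • dcoord 1
  | 2, w => dcoord 4 - w 6 • dcoord 0 - w 7 • dcoord 1

/-- The contact forms `ϖ₀, ϖ₁, ϖ₂` as differential `1`-forms on `Jet2`. -/
def contactForm (i : Fin 3) : Jet2 → Jet2 [⋀^Fin 1]→L[ℝ] ℝ :=
  fun w => ContinuousAlternatingMap.ofSubsingleton ℝ Jet2 ℝ 0 (contactCovector i w)

/-- The Grassmannian of `k`-dimensional linear subspaces of `E`. -/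
def Gr (k : ℕ) (E : Type*) [AddCommGroup E] [Module ℝ E] : Type _ :=
  {v : Submodule ℝ E // Module.finrank ℝ v = k}

/-- The span of a linearly independent `k`-frame. -/
def frameSpan (k : ℕ) (E : Type*) [AddCommGroup E] [Module ℝ E]
    (f : {f : Fin k → E // LinearIndependent ℝ f}) : Gr k E :=
  ⟨Submodule.span ℝ (Set.range f.1), by
    simpa using finrank_span_eq_card f.2⟩

/-- The usual topology of the Grassmannian: the quotient topology from the space of linearly
independent frames. -/
instance (k : ℕ) (E : Type*) [AddCommGroup E] [Module ℝ E] [TopologicalSpace E] :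
    TopologicalSpace (Gr k E) :=
  TopologicalSpace.coinduced (frameSpan k E) inferInstance

/-- The equation `R = {F = 0}`. -/
def eqn (F : Jet2 → ℝ) : Set Jet2 := {w | F w = 0}

/-- The partial derivative of `F` along the `i`-th coordinate at `w`. -/
def pd (F : Jet2 → ℝ) (i : Fin 8) (w : Jet2) : ℝ := fderiv ℝ F w (Pi.single i 1)

/-- `(F_r, F_s, F_t) ≠ (0, 0, 0)` at `w`. -/
def SymbolNeZero (F : Jet2 → ℝ) (w : Jet2) : Prop :=
  (pd F 5 w, pd F 6 w, pd F 7 w) ≠ (0, 0, 0)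

/-- `{F = 0}` is a regular second-order PDE: `F` is smooth and `(F_r, F_s, F_t)` does not vanish
on `{F = 0}`. -/
structure IsRegularPDE (F : Jet2 → ℝ) : Prop where
  smooth : ContDiff ℝ ∞ F
  regular : ∀ w ∈ eqn F, SymbolNeZero F w

/-- The discriminant `Δ = F_r F_t - F_s² / 4`. -/
def discriminant (F : Jet2 → ℝ) (w : Jet2) : ℝ :=
  pd F 5 w * pd F 7 w - pd F 6 w ^ 2 / 4

def IsHyperbolic (F : Jet2 → ℝ) (w : Jet2) : Prop := discriminant F w < 0

def IsParabolic (F : Jet2 → ℝ) (w : Jet2) : Prop :=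
  SymbolNeZero F w ∧ discriminant F w = 0

def IsElliptic (F : Jet2 → ℝ) (w : Jet2) : Prop := 0 < discriminant F w

/-- The tangent space `T_w R = ker dF_w` of the hypersurface `R = {F = 0}`, as a subspace of
`T_w Jet2 = Jet2`. -/
def tangentSpaceAt (F : Jet2 → ℝ) (w : Jet2) : Submodule ℝ Jet2 :=
  LinearMap.ker (fderiv ℝ F w : Jet2 →ₗ[ℝ] ℝ)

/-- The fibre at `w` of the induced differential system
`D = {ϖ₀|_R = ϖ₁|_R = ϖ₂|_R = 0}` on `R`. -/
def distribution (F : Jet2 → ℝ) (w : Jet2) : Submodule ℝ Jet2 :=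
  tangentSpaceAt F w ⊓ ⨅ i : Fin 3, LinearMap.ker (contactCovector i w : Jet2 →ₗ[ℝ] ℝ)

/-- The `1`-form `ϖ` on `Jet2` vanishes on the subspace `v` at `w`. -/
def OneFormVanishes (ϖ : Jet2 → Jet2 [⋀^Fin 1]→L[ℝ] ℝ) (w : Jet2) (v : Submodule ℝ Jet2) : Prop :=
  ∀ a ∈ v, ϖ w ![a] = 0

/-- The exterior derivative of the `1`-form `ϖ` vanishes on the subspace `v` at `w`. -/
def ExtDerivVanishes (ϖ : Jet2 → Jet2 [⋀^Fin 1]→L[ℝ] ℝ) (w : Jet2) (v : Submodule ℝ Jet2) :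
    Prop :=
  ∀ a ∈ v, ∀ b ∈ v, extDeriv ϖ w ![a, b] = 0

/-- `v` is a `2`-dimensional integral element of `(R, D)` at `w ∈ R`: a `2`-dimensional subspace
of `T_w R` on which all `ϖᵢ` and `dϖᵢ` vanish. As `v` is tangent to `R`, restricting `ϖᵢ` and
`dϖᵢ` to `v` agrees with restricting `ϖᵢ|_R` and `d(ϖᵢ|_R)` to `v`. -/
def IsIntegralElement (F : Jet2 → ℝ) (w : Jet2) (v : Gr 2 Jet2) : Prop :=
  v.1 ≤ tangentSpaceAt F w ∧
    ∀ i : Fin 3, OneFormVanishes (contactForm i) w v.1 ∧ ExtDerivVanishes (contactForm i) w v.1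

/-- The rank `2` prolongation `Σ(R)`: the pairs `(w, v)` of a point `w ∈ R` and a
`2`-dimensional integral element `v` at `w`. As a subtype of `R × Gr(2, 8)`, the restriction to
`R` of the Grassmann bundle of `2`-planes of `Jet2`, it carries the subspace topology. -/
def Prolongation (F : Jet2 → ℝ) : Type :=
  {u : eqn F × Gr 2 Jet2 // IsIntegralElement F u.1 u.2}

instance (F : Jet2 → ℝ) : TopologicalSpace (Prolongation F) :=
  inferInstanceAs (TopologicalSpace {u : eqn F × Gr 2 Jet2 // IsIntegralElement F u.1 u.2})

/-- The projection `p : Σ(R) → R`. -/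
def Prolongation.proj (F : Jet2 → ℝ) (u : Prolongation F) : eqn F := u.1.1

/-- The integral element underlying a point of `Σ(R)`. -/
def Prolongation.plane {F : Jet2 → ℝ} (u : Prolongation F) : Gr 2 Jet2 := u.1.2

/-- The fibre `p⁻¹(w)`, with the subspace topology. -/
abbrev fibre (F : Jet2 → ℝ) (w : eqn F) : Set (Prolongation F) :=
  Prolongation.proj F ⁻¹' {w}

/-- The torus `T² = S¹ × S¹`. -/
abbrev Torus : Type := Circle × Circle

/-- The equivalence relation on `T²` that collapses the circle `{1} × S¹` to one point. -/
def pinchSetoid : Setoid Torus where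
  r a b := a = b ∨ (a.1 = 1 ∧ b.1 = 1)
  iseqv :=
    { refl := fun _ => Or.inl rfl
      symm := by
        rintro a b (h | ⟨h, k⟩)
        · exact Or.inl h.symm
        · exact Or.inr ⟨k, h⟩
      trans := by
        rintro a b c (rfl | ⟨h, k⟩) (rfl | ⟨h', k'⟩)
        · exact Or.inl rfl
        · exact Or.inr ⟨h', k'⟩
        · exact Or.inr ⟨h, k⟩
        · exact Or.inr ⟨h, k'⟩ }

/-- The pinched torus: `T²` with one circle `{1} × S¹` collapsed to a point, with the quotient
topology. -/
abbrev PinchedTorus : Type := Quotient pinchSetoid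

/-- The unit sphere `S²` in Euclidean `ℝ³`. -/
abbrev Sphere2 : Type := Metric.sphere (0 : EuclideanSpace ℝ (Fin 3)) 1

end SecondOrderPDE

end

/-!
Linear algebra at the point `w` determines the integral planes; they are swept out by an explicit
compact family of frames, and elementary topological invariants distinguish the three surfaces
that arise.

On the vectors annihilated by the contact forms, `dϖ₁` and `dϖ₂` are the two components of the
vector-valued form `H' u - H u'`, where `u = (dx, dy)` and `H` is the symmetric matrix
`(dr ds; ds dt)`; the form `dϖ₀` vanishes there. The remaining equation `dF = 0` of `D(w)` is an
inhomogeneous linear equation for `H`, whose homogeneous part is the symbol `(F_r, F_s, F_t)` and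
whose right-hand side is linear in `u`. Since the symbol is nonzero, prolonging the equation
(`exists_cubic`) gives a cubic form by which `H` can be shifted so that the right-hand side
disappears, without changing `dϖ₁` and `dϖ₂`. A unimodular basis of covectors then yields
coordinates `(α, β, P, S, T)` (`nonempty_adaptedCoords`) in which everything depends only on the
values of the symbol, a binary quadratic form, on that basis. Bringing this form to its normal
form leaves three cases.

* Hyperbolic, `S = 0`: the equations decouple, and an integral plane is the sum of a line in each
  of two planes. The integral planes form `ℝP¹ × ℝP¹`, a torus.
* Elliptic, `T = -P`: the equations say that a complex determinant vanishes, and the integral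
  planes are the complex lines of `ℂ²`, parametrized by `S²` through the Hopf map.
* Parabolic, `T = 0`: the integral planes are a line bundle over `ℝP¹` together with one further
  plane, in which all the fibres of the bundle end on both sides. This is the pinched torus.

In each case a compact space `Y` of unit vectors carries a continuous family of integral frames.
As the Grassmannian is Hausdorff (`t2Space_gr`), the set of integral planes is a quotient of `Y`,
and the model surface is the quotient of `Y` by the same relation
(`AdaptedCoords.nonempty_homeomorph`).

For the converse implications the three surfaces have to be pairwise non-homeomorphic. The pinched
torus is the only one with a point whose removal disconnects all of its small neighbourhoods
(`LocallyConnectedPunctured`). Every circle-valued map on the sphere lifts to `ℝ`, while the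
first projection of the torus does not (`LiftsCircleMaps`).
-/

noncomputable section

/-! ### Local and global topology of the three model surfaces -/

namespace SecondOrderPDE

open Set Filter Topology Metric

/-- Every point has arbitrarily small neighbourhoods that stay connected when the point is
removed. This holds for manifolds of dimension at least `2`, and fails at a pinch point. -/
def LocallyConnectedPunctured (X : Type*) [TopologicalSpace X] : Prop :=
  ∀ x : X, ∀ U ∈ 𝓝 x, ∃ V ∈ 𝓝 x, V ⊆ U ∧ IsPreconnected (V \ {x})

/-- Every continuous map to the circle lifts to the universal cover `ℝ`. -/
def LiftsCircleMaps (X : Type*) [TopologicalSpace X] : Prop :=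
  ∀ f : C(X, Circle), ∃ g : C(X, ℝ), ∀ x, Circle.exp (g x) = f x

theorem LocallyConnectedPunctured.of_homeomorph {X Y : Type*} [TopologicalSpace X]
    [TopologicalSpace Y] (e : X ≃ₜ Y) (h : LocallyConnectedPunctured Y) :
    LocallyConnectedPunctured X := by
  intro x U hU
  have hU' : e.symm ⁻¹' U ∈ 𝓝 (e x) :=
    e.symm.continuous.continuousAt.preimage_mem_nhds (by simpa using hU)
  obtain ⟨V, hV, hVU, hc⟩ := h (e x) _ hU'
  refine ⟨e ⁻¹' V, e.continuous.continuousAt.preimage_mem_nhds hV, fun y hy => ?_, ?_⟩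
  · simpa using hVU hy
  · have : e ⁻¹' V \ {x} = e.symm '' (V \ {e x}) := by
      rw [e.symm.image_eq_preimage_symm]
      ext y
      simp
    rw [this]
    exact hc.image _ e.symm.continuous.continuousOn

theorem LiftsCircleMaps.of_homeomorph {X Y : Type*} [TopologicalSpace X]
    [TopologicalSpace Y] (e : X ≃ₜ Y) (h : LiftsCircleMaps Y) : LiftsCircleMaps X := by
  intro f
  obtain ⟨g, hg⟩ := h (f.comp ⟨e.symm, e.symm.continuous⟩)
  exact ⟨g.comp ⟨e, e.continuous⟩, fun x => by simpa using hg (e x)⟩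

theorem exists_nhds_diff_singleton_isPreconnected {X E : Type*} [TopologicalSpace X]
    [NormedAddCommGroup E] [NormedSpace ℝ E] (hE : 1 < Module.rank ℝ E)
    (φ : OpenPartialHomeomorph X E) {x : X} (hx : x ∈ φ.source) {U : Set X} (hU : U ∈ 𝓝 x) :
    ∃ V ∈ 𝓝 x, V ⊆ U ∧ IsPreconnected (V \ {x}) := by
  have h1 : φ.target ∩ φ.symm ⁻¹' U ∈ 𝓝 (φ x) :=
    inter_mem (φ.open_target.mem_nhds (φ.map_source hx))
      ((φ.symm.continuousAt (φ.map_source hx)).preimage_mem_nhds (by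
        simpa [φ.left_inv hx] using hU))
  obtain ⟨ε, hε, hB⟩ := Metric.mem_nhds_iff.1 h1
  have hcont : ContinuousOn φ.symm (ball (φ x) ε) :=
    φ.symm.continuousOn.mono fun y hy => (hB hy).1
  refine ⟨φ.symm '' ball (φ x) ε, ?_, ?_, ?_⟩
  · have := φ.symm.image_mem_nhds (φ.map_source hx) (ball_mem_nhds (φ x) hε)
    rwa [φ.left_inv hx] at this
  · rintro _ ⟨y, hy, rfl⟩
    exact (hB hy).2
  · have h2 : φ.symm '' ball (φ x) ε \ {x} = φ.symm '' (ball (φ x) ε \ {φ x}) := by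
      ext z
      constructor
      · rintro ⟨⟨y, hy, rfl⟩, hz⟩
        refine ⟨y, ⟨hy, fun h => hz ?_⟩, rfl⟩
        rw [mem_singleton_iff] at h ⊢
        rw [h, φ.left_inv hx]
      · rintro ⟨y, ⟨hy, hne⟩, rfl⟩
        refine ⟨⟨y, hy, rfl⟩, fun h => hne ?_⟩
        rw [mem_singleton_iff] at h ⊢
        rw [← h, φ.right_inv (hB hy).1]
    rw [h2]
    refine IsPreconnected.image ?_ _ (hcont.mono sdiff_subset)
    -- the punctured ball is the image of the punctured space under a homeomorphism
    have h3 : ball (φ x) ε \ {φ x} = OpenPartialHomeomorph.univBall (φ x) ε '' {0}ᶜ := by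
      have hinj : Function.Injective (OpenPartialHomeomorph.univBall (φ x) ε) := by
        intro a b hab
        exact (OpenPartialHomeomorph.univBall (φ x) ε).injOn (by simp) (by simp) hab
      have him : range (OpenPartialHomeomorph.univBall (φ x) ε) = ball (φ x) ε := by
        rw [← image_univ, ← OpenPartialHomeomorph.univBall_source (φ x) ε,
          OpenPartialHomeomorph.image_source_eq_target,
          OpenPartialHomeomorph.univBall_target _ hε]
      rw [image_compl_eq_range_sdiff_image hinj, him, image_singleton,
        OpenPartialHomeomorph.univBall_apply_zero]
    rw [h3]
    exact (isConnected_compl_singleton_of_one_lt_rank hE 0).isPreconnected.image _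
      (OpenPartialHomeomorph.continuous_univBall _ _).continuousOn

theorem locallyConnectedPunctured_torus : LocallyConnectedPunctured Torus := by
  rintro ⟨z, w⟩ U hU
  refine exists_nhds_diff_singleton_isPreconnected ?_
    ((chartAt (EuclideanSpace ℝ (Fin 1)) z).prod (chartAt (EuclideanSpace ℝ (Fin 1)) w))
    (x := (z, w)) (by simp) hU
  apply Module.one_lt_rank_of_one_lt_finrank
  simp

instance : Fact (Module.finrank ℝ (EuclideanSpace ℝ (Fin 3)) = 2 + 1) := ⟨by simp⟩

theorem locallyConnectedPunctured_sphere : LocallyConnectedPunctured Sphere2 := by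
  intro x U hU
  refine exists_nhds_diff_singleton_isPreconnected ?_ (chartAt (EuclideanSpace ℝ (Fin 2)) x)
    (mem_chart_source _ x) hU
  apply Module.one_lt_rank_of_one_lt_finrank
  simp

theorem circle_re_sq_add_im_sq (z : Circle) : (z : ℂ).re ^ 2 + (z : ℂ).im ^ 2 = 1 := by
  have := Circle.normSq_coe z
  rw [Complex.normSq_apply] at this
  linarith

/-- The pinch point separates its small neighbourhoods: the height `Im u` of the point with
coordinates `(u, v)` changes sign there, and vanishes only at the pinch point and at `u = -1`. -/
theorem not_locallyConnectedPunctured_pinchedTorus : ¬ LocallyConnectedPunctured PinchedTorus := by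
  intro h
  let g : PinchedTorus → ℝ := Quotient.lift (fun a : Torus => (a.1 : ℂ).im) (by
    rintro a b (rfl | ⟨h, k⟩)
    · rfl
    · simp [h, k])
  let ρ : PinchedTorus → ℝ := Quotient.lift (fun a : Torus => (a.1 : ℂ).re) (by
    rintro a b (rfl | ⟨h, k⟩)
    · rfl
    · simp [h, k])
  have hg : Continuous g := Continuous.quotient_lift (by fun_prop) _
  have hρ : Continuous ρ := Continuous.quotient_lift (by fun_prop) _
  let π : Torus → PinchedTorus := Quotient.mk pinchSetoid
  have hπ : Continuous π := continuous_quot_mk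
  obtain ⟨V, hV, hVU, hc⟩ := h (π (1, 1)) {y | 0 < ρ y}
    ((isOpen_lt continuous_const hρ).mem_nhds (by simp [ρ, π]))
  have hev : ∀ᶠ t : ℝ in 𝓝 0, π (Circle.exp t, 1) ∈ V := by
    have : ContinuousAt (fun t : ℝ => π (Circle.exp t, 1)) 0 := by
      apply Continuous.continuousAt
      fun_prop
    exact this.preimage_mem_nhds (by simpa using hV)
  obtain ⟨ε, hε, hB⟩ := Metric.eventually_nhds_iff.1 hev
  obtain ⟨t, ht0, ht⟩ : ∃ t : ℝ, 0 < t ∧ t < min ε Real.pi :=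
    exists_between (lt_min hε Real.pi_pos)
  have htε := ht.trans_le (min_le_left _ _)
  have hsin := Real.sin_pos_of_pos_of_lt_pi ht0 (ht.trans_le (min_le_right _ _))
  have him : ∀ t : ℝ, g (π (Circle.exp t, 1)) = Real.sin t := by
    intro t
    simp [g, π, Circle.coe_exp, Complex.exp_ofReal_mul_I_im]
  have hmem : ∀ t : ℝ, |t| < ε → Real.sin t ≠ 0 →
      π (Circle.exp t, 1) ∈ V \ {π (1, 1)} := by
    intro t ht hs
    refine ⟨hB (by simpa using ht), fun h => hs ?_⟩
    rw [← him, mem_singleton_iff.1 h]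
    simp [g, π]
  have h1 := hmem t (by rwa [abs_of_pos ht0]) hsin.ne'
  have h2 := hmem (-t) (by rwa [abs_neg, abs_of_pos ht0]) (by simpa using hsin.ne')
  obtain ⟨y, ⟨hyV, hy1⟩, hy0⟩ := hc.intermediate_value h2 h1 hg.continuousOn
    (show (0 : ℝ) ∈ Icc _ _ from ⟨by rw [him, Real.sin_neg]; linarith, by rw [him]; exact hsin.le⟩)
  have hyρ := hVU hyV
  induction y using Quotient.inductionOn with
  | h a =>
    refine hy1 (Quotient.sound (Or.inr ⟨?_, rfl⟩))
    replace hy0 : (a.1 : ℂ).im = 0 := hy0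
    replace hyρ : 0 < (a.1 : ℂ).re := hyρ
    have h3 := circle_re_sq_add_im_sq a.1
    ext
    rw [Circle.coe_one]
    apply Complex.ext
    · rw [hy0] at h3
      simp only [Complex.one_re]
      nlinarith
    · simpa using hy0

theorem not_liftsCircleMaps_torus : ¬ LiftsCircleMaps Torus := by
  intro h
  obtain ⟨g, hg⟩ := h ⟨Prod.fst, continuous_fst⟩
  -- By uniqueness of lifts, `t ↦ g (exp t, 1)` is a translation of `ℝ`; but it is periodic.
  have h0 : Circle.exp (g (1, 1)) = 1 := hg (1, 1)
  have key : (fun t : ℝ => g (Circle.exp t, 1)) = fun t => t + g (1, 1) := by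
    refine Circle.isCoveringMap_exp.eq_of_comp_eq (by fun_prop) (by fun_prop) ?_ 0 (by simp)
    funext t
    simp only [Function.comp_apply, Circle.exp_add, h0, mul_one]
    exact hg _
  have h1 := congrFun key (2 * Real.pi)
  simp only [Circle.exp_two_pi] at h1
  linarith [Real.pi_pos]

/-- A circle-valued map lifts over the complement of a point, which is a plane. -/
theorem exists_lift_sphere_compl_singleton (f : C(Sphere2, Circle)) (v : Sphere2) :
    ∃ g : Sphere2 → ℝ, ContinuousOn g {v}ᶜ ∧ ∀ x ∈ ({v}ᶜ : Set Sphere2),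
      Circle.exp (g x) = f x := by
  let φ := stereographic' 2 v
  have hcont : Continuous φ.symm := by
    have := φ.symm.continuousOn
    rwa [φ.symm_source, stereographic'_target, continuousOn_univ] at this
  let f' : C(EuclideanSpace ℝ (Fin 2), Circle) := f.comp ⟨φ.symm, hcont⟩
  obtain ⟨t, ht⟩ := Circle.exp_surjective (f' 0)
  obtain ⟨h, ⟨-, hh⟩, -⟩ :=
    Circle.isCoveringMap_exp.existsUnique_continuousMap_lifts f' 0 t ht
  refine ⟨h ∘ φ, ?_, fun x hx => ?_⟩
  · refine h.continuous.comp_continuousOn ?_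
    have := φ.continuousOn
    rwa [stereographic'_source] at this
  · have h1 := congrFun hh (φ x)
    have h2 : φ.symm (φ x) = x := φ.left_inv (by rw [stereographic'_source]; exact hx)
    simpa [f', h2] using h1

theorem isConnected_sphere_compl_pair {v v' : Sphere2} (h : v' ≠ v) :
    IsConnected ({v}ᶜ ∩ {v'}ᶜ : Set Sphere2) := by
  let φ := stereographic' 2 v
  have hcont : Continuous φ.symm := by
    have := φ.symm.continuousOn
    rwa [φ.symm_source, stereographic'_target, continuousOn_univ] at this
  have hs : φ.source = {v}ᶜ := stereographic'_source v
  have h1 : ({v}ᶜ ∩ {v'}ᶜ : Set Sphere2) = φ.symm '' {φ v'}ᶜ := by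
    have hinj : Function.Injective φ.symm := fun a b hab =>
      φ.symm.injOn (by simp [φ]) (by simp [φ]) hab
    have hr : range φ.symm = {v}ᶜ := by
      rw [← hs, ← φ.symm_image_target_eq_source, stereographic'_target, image_univ]
    rw [image_compl_eq_range_sdiff_image hinj, hr, image_singleton,
      φ.left_inv (by rw [hs]; exact h)]
    rfl
  rw [h1]
  refine (isConnected_compl_singleton_of_one_lt_rank ?_ _).image _ hcont.continuousOn
  apply Module.one_lt_rank_of_one_lt_finrank
  simp

/-- The lifts over the complements of two points differ by a constant, since the intersection of
these complements is connected, so that they can be glued. -/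
theorem liftsCircleMaps_sphere : LiftsCircleMaps Sphere2 := by
  intro f
  let v : Sphere2 := ⟨EuclideanSpace.single 0 1, by simp⟩
  have hv : -v ≠ v := by
    intro h
    have := congrArg (fun x : Sphere2 => (x : EuclideanSpace ℝ (Fin 3)) 0) h
    simp [v] at this
    linarith
  obtain ⟨g, hgc, hg⟩ := exists_lift_sphere_compl_singleton f v
  obtain ⟨k, hkc, hk⟩ := exists_lift_sphere_compl_singleton f (-v)
  obtain ⟨⟨x₀, hx₀⟩, hconn⟩ := isConnected_sphere_compl_pair hv
  have hc : Circle.exp (g x₀ - k x₀) = 1 := by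
    rw [Circle.exp_sub, hg _ hx₀.1, hk _ hx₀.2, div_self']
  have heq : EqOn g (fun x => k x + (g x₀ - k x₀)) ({v}ᶜ ∩ {-v}ᶜ) := by
    refine Circle.isCoveringMap_exp.eqOn_of_comp_eqOn hconn (hgc.mono inter_subset_left)
      ((hkc.mono inter_subset_right).add continuousOn_const) ?_ hx₀ (by simp)
    intro x hx
    simp only [Function.comp_apply, Circle.exp_add, hc, mul_one, hg _ hx.1, hk _ hx.2]
  classical
  have hsplit : ∀ x ∈ ({-v}ᶜ : Set Sphere2),
      (if x = v then k x + (g x₀ - k x₀) else g x) = k x + (g x₀ - k x₀) := by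
    intro x hx
    split_ifs with h
    · rfl
    · exact heq ⟨h, hx⟩
  refine ⟨⟨fun x => if x = v then k x + (g x₀ - k x₀) else g x, ?_⟩, fun x => ?_⟩
  · rw [continuous_iff_continuousAt]
    intro x
    by_cases hx : x = v
    · have hx' : ({-v}ᶜ : Set Sphere2) ∈ 𝓝 x :=
        isOpen_compl_singleton.mem_nhds (by rw [hx]; exact hv.symm)
      exact ((hkc.continuousAt hx').add continuousAt_const).congr
        (Filter.eventually_of_mem hx' fun y hy => (hsplit y hy).symm)
    · have hx' : ({v}ᶜ : Set Sphere2) ∈ 𝓝 x := isOpen_compl_singleton.mem_nhds hx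
      exact (hgc.continuousAt hx').congr
        (Filter.eventually_of_mem hx' fun y hy => (if_neg hy).symm)
  · by_cases hx : x = v
    · have hx' : x ∈ ({-v}ᶜ : Set Sphere2) := by rw [hx]; exact hv.symm
      simp only [ContinuousMap.coe_mk]
      rw [hsplit x hx', Circle.exp_add, hc, mul_one, hk x hx']
    · simp only [ContinuousMap.coe_mk, if_neg hx]
      exact hg x hx

theorem isEmpty_torus_homeomorph_pinchedTorus : IsEmpty (Torus ≃ₜ PinchedTorus) :=
  ⟨fun e => not_locallyConnectedPunctured_pinchedTorus
    (locallyConnectedPunctured_torus.of_homeomorph e.symm)⟩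

theorem isEmpty_sphere_homeomorph_pinchedTorus : IsEmpty (Sphere2 ≃ₜ PinchedTorus) :=
  ⟨fun e => not_locallyConnectedPunctured_pinchedTorus
    (locallyConnectedPunctured_sphere.of_homeomorph e.symm)⟩

theorem isEmpty_torus_homeomorph_sphere : IsEmpty (Torus ≃ₜ Sphere2) :=
  ⟨fun e => not_liftsCircleMaps_torus (liftsCircleMaps_sphere.of_homeomorph e)⟩

end SecondOrderPDE

/-! ### The Grassmannian is Hausdorff, and frames parametrize its subsets -/

namespace SecondOrderPDE

open Set Filter Topology Matrix

section Grassmannian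

theorem continuous_frameSpan (k : ℕ) (E : Type*) [AddCommGroup E] [Module ℝ E]
    [TopologicalSpace E] : Continuous (frameSpan k E) :=
  continuous_coinduced_rng

theorem surjective_frameSpan (k : ℕ) (E : Type*) [AddCommGroup E] [Module ℝ E]
    [FiniteDimensional ℝ E] : Function.Surjective (frameSpan k E) := by
  rintro ⟨v, hv⟩
  let b := Module.finBasisOfFinrankEq ℝ v hv
  refine ⟨⟨fun i => b i, b.linearIndependent.map' v.subtype (by simp)⟩, Subtype.ext ?_⟩
  change Submodule.span ℝ (range (v.subtype ∘ b)) = v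
  rw [range_comp, Submodule.span_image, b.span_eq, Submodule.map_top, Submodule.range_subtype]

variable {k n : ℕ}

/-- The foot of the perpendicular dropped from `x` to the span of the rows of `f`, computed with
the inverse of the Gram matrix of `f`. -/
def gramProj (f : Fin k → Fin n → ℝ) (x : Fin n → ℝ) : Fin n → ℝ :=
  ((of f * (of f)ᵀ)⁻¹ *ᵥ (of f *ᵥ x)) ᵥ* of f

theorem det_gram_ne_zero {f : Fin k → Fin n → ℝ} (hf : LinearIndependent ℝ f) :
    (of f * (of f)ᵀ).det ≠ 0 := by
  intro h
  obtain ⟨c, hc, h0⟩ := Matrix.exists_vecMul_eq_zero_iff.2 h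
  refine hc ?_
  have h1 : (c ᵥ* of f) ⬝ᵥ (c ᵥ* of f) = 0 := by
    have h2 : c ᵥ* (of f * (of f)ᵀ) ⬝ᵥ c = 0 := by rw [h0, zero_dotProduct]
    rwa [← vecMul_vecMul, vecMul_transpose, ← dotProduct_comm, dotProduct_mulVec] at h2
  rw [dotProduct_self_eq_zero, vecMul_eq_sum] at h1
  funext i
  exact Fintype.linearIndependent_iff.1 hf c h1 i

theorem gramProj_mem_span (f : Fin k → Fin n → ℝ) (x : Fin n → ℝ) :
    gramProj f x ∈ Submodule.span ℝ (range f) := by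
  rw [gramProj, vecMul_eq_sum]
  exact Submodule.sum_mem _ fun i _ =>
    Submodule.smul_mem _ _ (Submodule.subset_span (mem_range_self i))

theorem dotProduct_sub_gramProj {f : Fin k → Fin n → ℝ} (hf : LinearIndependent ℝ f)
    (x : Fin n → ℝ) {z : Fin n → ℝ} (hz : z ∈ Submodule.span ℝ (range f)) :
    z ⬝ᵥ (x - gramProj f x) = 0 := by
  have h : of f *ᵥ (x - gramProj f x) = 0 := by
    rw [mulVec_sub, gramProj, ← mulVec_transpose (of f), mulVec_mulVec, mulVec_mulVec,
      Matrix.mul_nonsing_inv _ (det_gram_ne_zero hf).isUnit, one_mulVec, sub_self]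
  induction hz using Submodule.span_induction with
  | mem z hz =>
    obtain ⟨i, rfl⟩ := hz
    exact congrFun h i
  | zero => simp
  | add a b _ _ ha hb => rw [add_dotProduct, ha, hb, add_zero]
  | smul c a _ ha => rw [smul_dotProduct, ha, smul_zero]

/-- The perpendicular foot depends only on the span of the frame. -/
theorem gramProj_eq_of_span_eq {f g : Fin k → Fin n → ℝ} (hf : LinearIndependent ℝ f)
    (hg : LinearIndependent ℝ g)
    (h : Submodule.span ℝ (range f) = Submodule.span ℝ (range g)) (x : Fin n → ℝ) :
    gramProj f x = gramProj g x := by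
  have hmem : gramProj f x - gramProj g x ∈ Submodule.span ℝ (range f) :=
    Submodule.sub_mem _ (gramProj_mem_span f x) (h ▸ gramProj_mem_span g x)
  have h1 := dotProduct_sub_gramProj hf x hmem
  have h2 := dotProduct_sub_gramProj hg x (h ▸ hmem)
  rw [← sub_eq_zero, ← dotProduct_self_eq_zero]
  rw [dotProduct_sub] at h1 h2 ⊢
  linarith

theorem gramProj_eq_self_iff {f : Fin k → Fin n → ℝ} (hf : LinearIndependent ℝ f)
    (x : Fin n → ℝ) : gramProj f x = x ↔ x ∈ Submodule.span ℝ (range f) := by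
  refine ⟨fun h => h ▸ gramProj_mem_span f x, fun h => ?_⟩
  have h1 := dotProduct_sub_gramProj hf x (Submodule.sub_mem _ h (gramProj_mem_span f x))
  exact (sub_eq_zero.1 (dotProduct_self_eq_zero.1 h1)).symm

theorem continuous_gramProj (x : Fin n → ℝ) :
    Continuous fun f : {f : Fin k → Fin n → ℝ // LinearIndependent ℝ f} => gramProj f.1 x := by
  have hM : Continuous fun f : {f : Fin k → Fin n → ℝ // LinearIndependent ℝ f} =>
      (of f.1 : Matrix (Fin k) (Fin n) ℝ) := continuous_subtype_val
  have hG := hM.matrix_mul hM.matrix_transpose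
  refine Continuous.matrix_vecMul (Continuous.matrix_mulVec ?_ (hM.matrix_mulVec
    continuous_const)) hM
  simp only [Matrix.inv_def, Ring.inverse_eq_inv']
  exact (hG.matrix_det.inv₀ fun f => det_gram_ne_zero f.2).smul hG.matrix_adjugate

/-- Distinct planes are separated by the orthogonal projections of a point lying on just one of
them. -/
instance t2Space_gr : T2Space (Gr k (Fin n → ℝ)) := by
  have hP : ∀ x : Fin n → ℝ, ∃ P : Gr k (Fin n → ℝ) → Fin n → ℝ, Continuous P ∧
      ∀ v, P v = x ↔ x ∈ v.1 := by
    intro x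
    let s := Function.surjInv (surjective_frameSpan k (Fin n → ℝ))
    have hs : ∀ v, frameSpan k (Fin n → ℝ) (s v) = v := Function.surjInv_eq _
    refine ⟨fun v => gramProj (s v).1 x, continuous_coinduced_dom.2 ?_, fun v => ?_⟩
    · convert! continuous_gramProj (k := k) x using 2 with f
      exact gramProj_eq_of_span_eq (s _).2 f.2 (congrArg Subtype.val (hs (frameSpan k _ f))) x
    · rw [gramProj_eq_self_iff (s v).2]
      exact iff_of_eq (congrArg (x ∈ ·) (congrArg Subtype.val (hs v)))
  refine ⟨fun v v' hne => ?_⟩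
  have : ∃ x ∈ v.1, x ∉ v'.1 := by
    by_contra! h
    exact hne (Subtype.ext (Submodule.eq_of_le_of_finrank_eq h (v.2.trans v'.2.symm)))
  obtain ⟨x, hx, hx'⟩ := this
  obtain ⟨P, hPc, hP⟩ := hP x
  exact separated_by_continuous hPc fun h => hx' ((hP v').1 (h ▸ (hP v).2 hx))

/-- A set of planes swept out by a family of frames over a compact space `Y` is the quotient of
`Y` that identifies frames of the same plane. -/
theorem nonempty_homeomorph_of_frames {X Y : Type*} [TopologicalSpace X] [TopologicalSpace Y]
    [CompactSpace Y] {q : Y → X} (hq : IsQuotientMap q) {S : Set (Gr k (Fin n → ℝ))}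
    {φ : Y → Fin k → Fin n → ℝ} (hφ : Continuous φ) (hli : ∀ y, LinearIndependent ℝ (φ y))
    (hS : ∀ v, v ∈ S ↔ ∃ y, frameSpan k (Fin n → ℝ) ⟨φ y, hli y⟩ = v)
    (hker : ∀ y y', Submodule.span ℝ (range (φ y)) = Submodule.span ℝ (range (φ y')) ↔
      q y = q y') : Nonempty (S ≃ₜ X) := by
  let g : Y → S := fun y => ⟨frameSpan k (Fin n → ℝ) ⟨φ y, hli y⟩, (hS _).2 ⟨y, rfl⟩⟩
  have hgc : Continuous g :=
    ((continuous_frameSpan k _).comp (hφ.subtype_mk hli)).subtype_mk _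
  have hgs : Function.Surjective g := by
    rintro ⟨v, hv⟩
    obtain ⟨y, hy⟩ := (hS v).1 hv
    exact ⟨y, Subtype.ext hy⟩
  have hg : IsQuotientMap g := hgc.isClosedMap.isQuotientMap hgc hgs
  have hk : Setoid.ker g = Setoid.ker q := by
    ext y y'
    exact (Subtype.ext_iff.trans Subtype.ext_iff).trans (hker y y')
  let e₁ : Quotient (Setoid.ker g) ≃ₜ S := IsQuotientMap.homeomorph (f := ⟨g, hgc⟩) hg
  let e₂ : Quotient (Setoid.ker q) ≃ₜ X := IsQuotientMap.homeomorph (f := ⟨q, hq.continuous⟩) hq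
  clear_value e₁
  rw [hk] at e₁
  exact ⟨e₁.symm.trans e₂⟩

end Grassmannian

end SecondOrderPDE

/-! ### Integral elements in coordinates -/

namespace SecondOrderPDE

open Set Filter Topology Module

/-- The derivative of the contact covectors, which are affine in the point. -/
def contactDeriv (i : Fin 3) (a : Jet2) : Jet2 →L[ℝ] ℝ :=
  contactCovector i a - contactCovector i 0

theorem contactDeriv_isLinear (i : Fin 3) (c : Jet2) :
    IsLinearMap ℝ fun a => contactDeriv i a c := by
  constructor <;> intros <;> fin_cases i <;> simp [contactDeriv, contactCovector] <;> ring

theorem contactCovector_eq_add (i : Fin 3) (w : Jet2) :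
    contactCovector i w = contactCovector i 0 + contactDeriv i w := by
  simp [contactDeriv]

theorem differentiable_contactForm (i : Fin 3) : Differentiable ℝ (contactForm i) := by
  have h : Differentiable ℝ (contactCovector i) := by
    fin_cases i
    · change Differentiable ℝ fun w : Jet2 => dcoord 2 - w 3 • dcoord 0 - w 4 • dcoord 1
      fun_prop
    · change Differentiable ℝ fun w : Jet2 => dcoord 3 - w 5 • dcoord 0 - w 6 • dcoord 1
      fun_prop
    · change Differentiable ℝ fun w : Jet2 => dcoord 4 - w 6 • dcoord 0 - w 7 • dcoord 1
      fun_prop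
  exact (ContinuousAlternatingMap.ofSubsingletonLIE (𝕜 := ℝ)
    (E := Jet2) (F := ℝ) (0 : Fin 1)).differentiable.comp h

theorem extDeriv_contactForm (i : Fin 3) (w a b : Jet2) :
    extDeriv (contactForm i) w ![a, b] = contactDeriv i a b - contactDeriv i b a := by
  have hf : ∀ c : Fin 1 → Jet2, ∀ x, fderiv ℝ (fun w => contactForm i w c) w x =
      contactDeriv i x (c 0) := by
    intro c x
    have h1 : (fun w => contactForm i w c) = fun w => contactCovector i 0 (c 0) +
        LinearMap.toContinuousLinearMap ((contactDeriv_isLinear i (c 0)).mk' _) w := by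
      funext w
      simp only [contactForm, ContinuousAlternatingMap.ofSubsingleton_apply_apply,
        LinearMap.coe_toContinuousLinearMap', IsLinearMap.mk'_apply]
      rw [contactCovector_eq_add, add_apply]
    rw [h1, fderiv_const_add, ContinuousLinearMap.fderiv]
    simp
  rw [extDeriv_apply (differentiable_contactForm i w), Fin.sum_univ_two, hf, hf]
  simp [Fin.removeNth, sub_eq_add_neg]

theorem mem_distribution {F : Jet2 → ℝ} {w v : Jet2} :
    v ∈ distribution F w ↔ ∑ i, pd F i w * v i = 0 ∧ v 2 = w 3 * v 0 + w 4 * v 1 ∧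
      v 3 = w 5 * v 0 + w 6 * v 1 ∧ v 4 = w 6 * v 0 + w 7 * v 1 := by
  have h : fderiv ℝ F w v = ∑ i, pd F i w * v i := by
    conv_lhs => rw [pi_eq_sum_univ' v]
    simp [pd, map_sum, mul_comm]
  simp only [distribution, tangentSpaceAt, Submodule.mem_inf, LinearMap.mem_ker,
    Submodule.mem_iInf, ContinuousLinearMap.coe_coe, h, Fin.forall_fin_succ]
  simp [contactCovector, sub_sub, sub_eq_zero]

theorem extDeriv_contactForm_zero (w a b : Jet2) :
    extDeriv (contactForm 0) w ![a, b] = a 0 * b 3 - b 0 * a 3 + a 1 * b 4 - b 1 * a 4 := by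
  rw [extDeriv_contactForm]
  simp [contactDeriv, contactCovector]
  ring

theorem extDeriv_contactForm_one (w a b : Jet2) :
    extDeriv (contactForm 1) w ![a, b] = a 0 * b 5 - b 0 * a 5 + a 1 * b 6 - b 1 * a 6 := by
  rw [extDeriv_contactForm]
  simp [contactDeriv, contactCovector]
  ring

theorem extDeriv_contactForm_two (w a b : Jet2) :
    extDeriv (contactForm 2) w ![a, b] = a 0 * b 6 - b 0 * a 6 + a 1 * b 7 - b 1 * a 7 := by
  rw [extDeriv_contactForm]
  simp [contactDeriv, contactCovector]
  ring

/-- The equations `dϖ₀ = 0` and `ϖᵢ = 0` are built into `D`: on `D` the form `dϖ₀` vanishes by the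
symmetry of the Hessian `(r, s, t)`. -/
theorem isIntegralElement_iff {F : Jet2 → ℝ} {w : Jet2} {v : Gr 2 Jet2} :
    IsIntegralElement F w v ↔ v.1 ≤ distribution F w ∧
      ExtDerivVanishes (contactForm 1) w v.1 ∧ ExtDerivVanishes (contactForm 2) w v.1 := by
  have hone : ∀ i, OneFormVanishes (contactForm i) w v.1 ↔
      v.1 ≤ LinearMap.ker (contactCovector i w : Jet2 →ₗ[ℝ] ℝ) := by
    intro i
    simp [OneFormVanishes, contactForm, SetLike.le_def]
  constructor
  · rintro ⟨h1, h2⟩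
    exact ⟨le_inf h1 (le_iInf fun i => (hone i).1 (h2 i).1), (h2 1).2, (h2 2).2⟩
  · rintro ⟨h1, h2, h3⟩
    refine ⟨h1.trans inf_le_left, fun i => ⟨(hone i).2 (h1.trans (inf_le_right.trans
      (iInf_le _ i))), ?_⟩⟩
    fin_cases i
    · intro a ha b hb
      obtain ⟨-, -, ha3, ha4⟩ := mem_distribution.1 (h1 ha)
      obtain ⟨-, -, hb3, hb4⟩ := mem_distribution.1 (h1 hb)
      change extDeriv (contactForm 0) w ![a, b] = 0
      rw [extDeriv_contactForm_zero, ha3, ha4, hb3, hb4]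
      ring
    · exact h2
    · exact h3

/-- The planes `v ⊂ D(w)` with `dϖ₁|_v = dϖ₂|_v = 0`. -/
def integralPlanes (F : Jet2 → ℝ) (w : Jet2) : Set (Gr 2 Jet2) :=
  {v | v.1 ≤ distribution F w ∧
    ExtDerivVanishes (contactForm 1) w v.1 ∧ ExtDerivVanishes (contactForm 2) w v.1}

theorem plane_image_fibre (F : Jet2 → ℝ) (w : eqn F) :
    Prolongation.plane '' fibre F w = integralPlanes F w := by
  ext v
  constructor
  · rintro ⟨⟨⟨w', v'⟩, h⟩, hw, rfl⟩
    obtain rfl : w' = w := hw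
    exact isIntegralElement_iff.1 h
  · intro h
    exact ⟨⟨(w, v), isIntegralElement_iff.2 h⟩, rfl, rfl⟩

/-- The fibre `p⁻¹(w)` is homeomorphic to the corresponding subspace of the Grassmannian. -/
def fibreHomeomorph (F : Jet2 → ℝ) (w : eqn F) : fibre F w ≃ₜ integralPlanes F w where
  toFun u := ⟨u.1.1.2, by
    rw [← plane_image_fibre]
    exact ⟨u.1, u.2, rfl⟩⟩
  invFun v := ⟨⟨(w, v.1), isIntegralElement_iff.2 v.2⟩, rfl⟩
  left_inv := by
    rintro ⟨⟨⟨w', v'⟩, h⟩, hw⟩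
    obtain rfl : w' = w := hw
    rfl
  right_inv _ := rfl
  continuous_toFun := by
    refine Continuous.subtype_mk ?_ _
    exact continuous_snd.comp (continuous_subtype_val.comp continuous_subtype_val)
  continuous_invFun := by
    refine Continuous.subtype_mk ?_ _
    exact Continuous.subtype_mk (continuous_const.prodMk continuous_subtype_val) _

/-! ### Coordinates of `D(w)` adapted to the symbol -/

/-- The value of the symbol `F_r ξ² + F_s ξη + F_t η²`, a quadratic form on covectors. -/
def symbolForm (F : Jet2 → ℝ) (w : Jet2) (e : ℝ × ℝ) : ℝ :=
  pd F 5 w * e.1 ^ 2 + pd F 6 w * (e.1 * e.2) + pd F 7 w * e.2 ^ 2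

/-- Twice the polarization of the symbol. -/
def symbolPolar (F : Jet2 → ℝ) (w : Jet2) (e k : ℝ × ℝ) : ℝ :=
  2 * pd F 5 w * (e.1 * k.1) + pd F 6 w * (e.1 * k.2 + e.2 * k.1) + 2 * pd F 7 w * (e.2 * k.2)

/-- The equations of integral elements in adapted coordinates `(α, β, P, S, T)`: the product of
the symmetric matrix `(P S; S T)` with the vector `(α, β)`, polarized alternatingly, vanishes. -/
def ModelIntegral (m m' : Fin 5 → ℝ) : Prop :=
  m 2 * m' 0 + m 3 * m' 1 - m' 2 * m 0 - m' 3 * m 1 = 0 ∧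
    m 3 * m' 0 + m 4 * m' 1 - m' 3 * m 0 - m' 4 * m 1 = 0

/-- Linear coordinates `(α, β, P, S, T)` on the vectors annihilated by the `ϖᵢ`, in which `D(w)`
is the hyperplane `a P + b S + c T = 0` and the forms `dϖ₁, dϖ₂` have constant coefficients.
In `nonempty_adaptedCoords`, `(α, β)` are coordinates of the base vector `(dx, dy)`, and `(P, S, T)`
those of the Hessian part `(dr, ds, dt)` after a shift depending linearly on `(dx, dy)`. Only the
properties that describe `D(w)` and its integral planes are recorded. -/
structure AdaptedCoords (F : Jet2 → ℝ) (w : Jet2) (a b c : ℝ) where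
  toJet : (Fin 5 → ℝ) →ₗ[ℝ] Jet2
  injective : Function.Injective toJet
  mem_iff : ∀ v, v ∈ distribution F w ↔
    ∃ m, a * m 2 + b * m 3 + c * m 4 = 0 ∧ toJet m = v
  integral_iff : ∀ m m', (extDeriv (contactForm 1) w ![toJet m, toJet m'] = 0 ∧
    extDeriv (contactForm 2) w ![toJet m, toJet m'] = 0) ↔ ModelIntegral m m'

/-- Prolonging the equation once gives two linear equations for the four third-order derivatives
`(z_xxx, z_xxy, z_xyy, z_yyy)`. They are solvable as soon as the symbol is nonzero. -/
theorem exists_cubic {A B C : ℝ} (h : (A, B, C) ≠ (0, 0, 0)) (g g' : ℝ) :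
    ∃ c₀ c₁ c₂ c₃ : ℝ, A * c₀ + B * c₁ + C * c₂ = g ∧ A * c₁ + B * c₂ + C * c₃ = g' := by
  by_cases hA : A = 0
  · by_cases hC : C = 0
    · have hB : B ≠ 0 := by
        rintro rfl
        exact h (by rw [hA, hC])
      exact ⟨0, g / B, g' / B, 0, by subst hA hC; field_simp; ring,
        by subst hA hC; field_simp; ring⟩
    · exact ⟨0, 0, g / C, (g' - B * (g / C)) / C, by field_simp; ring, by field_simp; ring⟩
  · exact ⟨(g - B * (g' / A)) / A, g' / A, 0, 0, by field_simp; ring, by field_simp; ring⟩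

/-- A unimodular basis `e, k` of covectors gives adapted coordinates: `α = e · (dx, dy)`,
`β = k · (dx, dy)`, and the Hessian part is `P e² + 2 S e k + T k²`, up to a shift by a cubic form
that absorbs the lower-order terms of `dF` and does not affect `dϖ₁` and `dϖ₂`. -/
theorem nonempty_adaptedCoords {F : Jet2 → ℝ} {w : Jet2} (hw : SymbolNeZero F w) (e k : ℝ × ℝ)
    (hek : e.1 * k.2 - e.2 * k.1 = 1) :
    Nonempty (AdaptedCoords F w (symbolForm F w e) (symbolPolar F w e k) (symbolForm F w k)) := by
  obtain ⟨e₁, e₂⟩ := e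
  obtain ⟨k₁, k₂⟩ := k
  simp only at hek
  obtain ⟨c₀, c₁, c₂, c₃, h₁, h₂⟩ := exists_cubic hw
    (-(pd F 0 w + w 3 * pd F 2 w + w 5 * pd F 3 w + w 6 * pd F 4 w))
    (-(pd F 1 w + w 4 * pd F 2 w + w 6 * pd F 3 w + w 7 * pd F 4 w))
  let f : (Fin 5 → ℝ) → Jet2 := fun m =>
    let u₁ := k₂ * m 0 - e₂ * m 1
    let u₂ := e₁ * m 1 - k₁ * m 0
    ![u₁, u₂, w 3 * u₁ + w 4 * u₂, w 5 * u₁ + w 6 * u₂, w 6 * u₁ + w 7 * u₂,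
      m 2 * e₁ ^ 2 + 2 * m 3 * (e₁ * k₁) + m 4 * k₁ ^ 2 + (c₀ * u₁ + c₁ * u₂),
      m 2 * (e₁ * e₂) + m 3 * (e₁ * k₂ + e₂ * k₁) + m 4 * (k₁ * k₂) + (c₁ * u₁ + c₂ * u₂),
      m 2 * e₂ ^ 2 + 2 * m 3 * (e₂ * k₂) + m 4 * k₂ ^ 2 + (c₂ * u₁ + c₃ * u₂)]
  have hf : IsLinearMap ℝ f := by
    constructor
    · intro a b
      funext i
      fin_cases i <;> simp [f] <;> ring
    · intro a b
      funext i
      fin_cases i <;> simp [f] <;> ring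
  -- the inverse coordinates, defined on the vectors annihilated by the contact forms
  let θ : Jet2 → Fin 5 → ℝ := fun v =>
    let ρ := v 5 - (c₀ * v 0 + c₁ * v 1)
    let σ := v 6 - (c₁ * v 0 + c₂ * v 1)
    let τ := v 7 - (c₂ * v 0 + c₃ * v 1)
    ![e₁ * v 0 + e₂ * v 1, k₁ * v 0 + k₂ * v 1,
      ρ * k₂ ^ 2 - 2 * σ * (k₁ * k₂) + τ * k₁ ^ 2,
      -(ρ * (e₂ * k₂)) + σ * (e₁ * k₂ + e₂ * k₁) - τ * (e₁ * k₁),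
      ρ * e₂ ^ 2 - 2 * σ * (e₁ * e₂) + τ * e₁ ^ 2]
  have hθf : ∀ m, θ (f m) = m := by
    intro m
    funext i
    fin_cases i <;> simp [f, θ]
    · linear_combination m 0 * hek
    · linear_combination m 1 * hek
    · linear_combination m 2 * (e₁ * k₂ - e₂ * k₁ + 1) * hek
    · linear_combination m 3 * (e₁ * k₂ - e₂ * k₁ + 1) * hek
    · linear_combination m 4 * (e₁ * k₂ - e₂ * k₁ + 1) * hek
  have hfθ : ∀ v : Jet2, v 2 = w 3 * v 0 + w 4 * v 1 → v 3 = w 5 * v 0 + w 6 * v 1 →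
      v 4 = w 6 * v 0 + w 7 * v 1 → f (θ v) = v := by
    intro v h2 h3 h4
    have h0 : k₂ * (e₁ * v 0 + e₂ * v 1) - e₂ * (k₁ * v 0 + k₂ * v 1) = v 0 := by
      linear_combination v 0 * hek
    have h1 : e₁ * (k₁ * v 0 + k₂ * v 1) - k₁ * (e₁ * v 0 + e₂ * v 1) = v 1 := by
      linear_combination v 1 * hek
    funext i
    fin_cases i <;> simp [f, θ, h0, h1, h2, h3, h4]
    · linear_combination (v 5 - (c₀ * v 0 + c₁ * v 1)) * (e₁ * k₂ - e₂ * k₁ + 1) * hek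
    · linear_combination (v 6 - (c₁ * v 0 + c₂ * v 1)) * (e₁ * k₂ - e₂ * k₁ + 1) * hek
    · linear_combination (v 7 - (c₂ * v 0 + c₃ * v 1)) * (e₁ * k₂ - e₂ * k₁ + 1) * hek
  have hdF : ∀ m, ∑ i, pd F i w * f m i = symbolForm F w (e₁, e₂) * m 2 +
      symbolPolar F w (e₁, e₂) (k₁, k₂) * m 3 + symbolForm F w (k₁, k₂) * m 4 := by
    intro m
    simp [Fin.sum_univ_eight, f, symbolForm, symbolPolar]
    linear_combination (k₂ * m 0 - e₂ * m 1) * h₁ + (e₁ * m 1 - k₁ * m 0) * h₂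
  refine ⟨⟨hf.mk' f, Function.LeftInverse.injective hθf, fun v => ?_, fun m m' => ?_⟩⟩
  · rw [mem_distribution]
    constructor
    · rintro ⟨h0, h2, h3, h4⟩
      have hv := hfθ v h2 h3 h4
      exact ⟨θ v, by rw [← hdF, hv, h0], hv⟩
    · rintro ⟨m, hm, rfl⟩
      refine ⟨by rw [← hm, ← hdF]; rfl, ?_, ?_, ?_⟩ <;> simp [f]
  · simp only [IsLinearMap.mk'_apply, ModelIntegral]
    set X := m 2 * m' 0 + m 3 * m' 1 - m' 2 * m 0 - m' 3 * m 1 with hX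
    set Y := m 3 * m' 0 + m 4 * m' 1 - m' 3 * m 0 - m' 4 * m 1 with hY
    have hx : extDeriv (contactForm 1) w ![f m, f m'] = -(X * e₁ + Y * k₁) := by
      rw [extDeriv_contactForm_one]
      simp [f]
      linear_combination -(X * e₁ + Y * k₁) * hek
    have hy : extDeriv (contactForm 2) w ![f m, f m'] = -(X * e₂ + Y * k₂) := by
      rw [extDeriv_contactForm_two]
      simp [f]
      linear_combination -(X * e₂ + Y * k₂) * hek
    rw [hx, hy]
    constructor
    · rintro ⟨h1, h2⟩
      exact ⟨by linear_combination -k₂ * h1 + k₁ * h2 - X * hek,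
        by linear_combination e₂ * h1 - e₁ * h2 - Y * hek⟩
    · rintro ⟨h1, h2⟩
      simp [h1, h2]

theorem finrank_distribution {F : Jet2 → ℝ} {w : Jet2} (hw : SymbolNeZero F w) :
    finrank ℝ (distribution F w) = 4 := by
  obtain ⟨Ψ⟩ := nonempty_adaptedCoords hw (1, 0) (0, 1) (by norm_num)
  let l : (Fin 5 → ℝ) →ₗ[ℝ] ℝ := pd F 5 w • LinearMap.proj 2 + (pd F 6 w) • LinearMap.proj 3 +
    pd F 7 w • LinearMap.proj 4
  have hl : l ≠ 0 := by
    intro h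
    refine hw ?_
    have h2 := LinearMap.congr_fun h (Pi.single 2 1)
    have h3 := LinearMap.congr_fun h (Pi.single 3 1)
    have h4 := LinearMap.congr_fun h (Pi.single 4 1)
    simp [l] at h2 h3 h4
    rw [h2, h3, h4]
  have hD : distribution F w = (LinearMap.ker l).map Ψ.toJet := by
    ext v
    rw [Ψ.mem_iff, Submodule.mem_map]
    simp [l, symbolForm, symbolPolar]
  have h := Module.Dual.finrank_ker_add_one_of_ne_zero hl
  rw [hD, ← (Submodule.equivMapOfInjective _ Ψ.injective _).finrank_eq]
  simp only [finrank_fin_fun] at h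
  omega

/-! ### Normal forms of the symbol -/

/-- The discriminant is invariant under unimodular changes of basis. -/
theorem symbolPolar_sq_sub {F : Jet2 → ℝ} {w : Jet2} {e k : ℝ × ℝ}
    (hek : e.1 * k.2 - e.2 * k.1 = 1) :
    symbolPolar F w e k ^ 2 - 4 * symbolForm F w e * symbolForm F w k =
      -4 * discriminant F w := by
  simp only [symbolPolar, symbolForm, discriminant]
  linear_combination (pd F 6 w ^ 2 - 4 * pd F 5 w * pd F 7 w) *
    (e.1 * k.2 - e.2 * k.1 + 1) * hek

/-- A hyperbolic symbol is a product of two independent linear factors. -/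
theorem IsHyperbolic.exists_basis {F : Jet2 → ℝ} {w : Jet2} (h : IsHyperbolic F w) :
    ∃ e k : ℝ × ℝ, e.1 * k.2 - e.2 * k.1 = 1 ∧ symbolForm F w e = 0 ∧
      symbolPolar F w e k ≠ 0 ∧ symbolForm F w k = 0 := by
  suffices ∃ e k : ℝ × ℝ, e.1 * k.2 - e.2 * k.1 = 1 ∧ symbolForm F w e = 0 ∧
      symbolForm F w k = 0 by
    obtain ⟨e, k, hek, he, hk⟩ := this
    refine ⟨e, k, hek, he, fun hc => ?_, hk⟩
    have := symbolPolar_sq_sub (F := F) (w := w) hek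
    rw [hc, he] at this
    have h' : discriminant F w < 0 := h
    linarith
  simp only [IsHyperbolic, discriminant] at h
  simp only [symbolForm]
  generalize pd F 5 w = A at *
  generalize pd F 6 w = B at *
  generalize pd F 7 w = C at *
  by_cases hA : A = 0
  · have hB : B ≠ 0 := by
      rintro rfl
      simp [hA] at h
    exact ⟨(1, 0), (-C / B, 1), by norm_num, by simp [hA], by simp [hA]; field_simp; ring⟩
  · have hpos : 0 < B ^ 2 - 4 * A * C := by linarith
    obtain ⟨s, hs, hs2⟩ : ∃ s : ℝ, s ≠ 0 ∧ s ^ 2 = B ^ 2 - 4 * A * C :=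
      ⟨√(B ^ 2 - 4 * A * C), (Real.sqrt_pos.2 hpos).ne', Real.sq_sqrt hpos.le⟩
    refine ⟨((-B + s) / (2 * A), 1), ((-B - s) / (2 * s), A / s), ?_, ?_, ?_⟩
    · field_simp; ring
    · field_simp
      linear_combination hs2
    · field_simp
      linear_combination A * hs2

/-- A parabolic symbol is a multiple of the square of a linear form. -/
theorem IsParabolic.exists_basis {F : Jet2 → ℝ} {w : Jet2} (h : IsParabolic F w) :
    ∃ e k : ℝ × ℝ, e.1 * k.2 - e.2 * k.1 = 1 ∧ symbolForm F w e = 0 ∧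
      symbolPolar F w e k = 0 ∧ symbolForm F w k ≠ 0 := by
  suffices ∃ e k : ℝ × ℝ, e.1 * k.2 - e.2 * k.1 = 1 ∧ symbolForm F w e = 0 ∧
      symbolForm F w k ≠ 0 by
    obtain ⟨e, k, hek, he, hk⟩ := this
    refine ⟨e, k, hek, he, ?_, hk⟩
    have := symbolPolar_sq_sub (F := F) (w := w) hek
    rw [he, h.2] at this
    simpa using this
  obtain ⟨h0, h⟩ := h
  simp only [SymbolNeZero, discriminant] at h0 h
  simp only [symbolForm]
  generalize pd F 5 w = A at *
  generalize pd F 6 w = B at *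
  generalize pd F 7 w = C at *
  by_cases hA : A = 0
  · subst hA
    have hB : B = 0 := by simpa using h
    have hC : C ≠ 0 := by
      rintro rfl
      exact h0 (by rw [hB])
    exact ⟨(1, 0), (0, 1), by norm_num, by simp, by simpa using hC⟩
  · refine ⟨(-B / (2 * A), 1), (-1, 0), by norm_num, ?_, by simpa using hA⟩
    field_simp
    linear_combination 4 * h

/-- An elliptic symbol is a multiple of a sum of two squares. -/
theorem IsElliptic.exists_basis {F : Jet2 → ℝ} {w : Jet2} (h : IsElliptic F w) :
    ∃ e k : ℝ × ℝ, e.1 * k.2 - e.2 * k.1 = 1 ∧ symbolForm F w e ≠ 0 ∧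
      symbolPolar F w e k = 0 ∧ symbolForm F w k = symbolForm F w e := by
  simp only [IsElliptic, discriminant] at h
  simp only [symbolForm, symbolPolar]
  generalize pd F 5 w = A at *
  generalize pd F 6 w = B at *
  generalize pd F 7 w = C at *
  have hA : A ≠ 0 := by
    rintro rfl
    nlinarith [sq_nonneg B]
  have hD : 0 < (A * C - B ^ 2 / 4) / A ^ 2 := by positivity
  -- completing the square, `Q (x, y) = A ((x + B y / (2 A))² + D y²)` with `D = l⁴`
  obtain ⟨l, hl, hl4⟩ : ∃ l : ℝ, l ≠ 0 ∧ l ^ 4 = (A * C - B ^ 2 / 4) / A ^ 2 := by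
    refine ⟨√√((A * C - B ^ 2 / 4) / A ^ 2),
      (Real.sqrt_pos.2 (Real.sqrt_pos.2 hD)).ne', ?_⟩
    rw [show (4 : ℕ) = 2 * 2 from rfl, pow_mul, Real.sq_sqrt (Real.sqrt_nonneg _),
      Real.sq_sqrt hD.le]
  rw [eq_div_iff (by positivity)] at hl4
  refine ⟨(l, 0), (-B / (2 * A * l), 1 / l), ?_, ?_, ?_, ?_⟩
  · field_simp; ring
  · simpa using ⟨hA, hl⟩
  · field_simp; ring
  · field_simp
    linear_combination -4 * hl4

end SecondOrderPDE

namespace SecondOrderPDE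

open Set Filter Topology Module Submodule

/-! ### Integral planes swept out by frames in adapted coordinates -/

theorem ModelIntegral.of_mem_span {m₁ m₂ x y : Fin 5 → ℝ} (h : ModelIntegral m₁ m₂)
    (hx : x ∈ span ℝ {m₁, m₂}) (hy : y ∈ span ℝ {m₁, m₂}) : ModelIntegral x y := by
  obtain ⟨s, t, rfl⟩ := mem_span_pair.1 hx
  obtain ⟨s', t', rfl⟩ := mem_span_pair.1 hy
  obtain ⟨h1, h2⟩ := h
  constructor <;> simp only [Pi.add_apply, Pi.smul_apply, smul_eq_mul]
  · linear_combination (s * t' - t * s') * h1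
  · linear_combination (s * t' - t * s') * h2

/-- The integral planes at `w` are the quotient of any compact family of integral frames in
adapted coordinates that reaches every integral plane, under the relation of spanning the same
plane. -/
theorem AdaptedCoords.nonempty_homeomorph {F : Jet2 → ℝ} {w : Jet2} {a b c : ℝ}
    (Ψ : AdaptedCoords F w a b c) {X Y : Type*} [TopologicalSpace X] [TopologicalSpace Y]
    [CompactSpace Y] {q : Y → X} (hq : IsQuotientMap q) {φ ψ : Y → Fin 5 → ℝ}
    (hφ : Continuous φ) (hψ : Continuous ψ)
    (hli : ∀ y, LinearIndependent ℝ ![φ y, ψ y])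
    (hφD : ∀ y, a * φ y 2 + b * φ y 3 + c * φ y 4 = 0)
    (hψD : ∀ y, a * ψ y 2 + b * ψ y 3 + c * ψ y 4 = 0)
    (hint : ∀ y, ModelIntegral (φ y) (ψ y))
    (hex : ∀ m m', a * m 2 + b * m 3 + c * m 4 = 0 → a * m' 2 + b * m' 3 + c * m' 4 = 0 →
      ModelIntegral m m' → ∃ y, m ∈ span ℝ {φ y, ψ y} ∧ m' ∈ span ℝ {φ y, ψ y})
    (hspan : ∀ y y', q y = q y' → φ y ∈ span ℝ {φ y', ψ y'} ∧ ψ y ∈ span ℝ {φ y', ψ y'})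
    (hinj : ∀ y y', φ y ∈ span ℝ {φ y', ψ y'} → ψ y ∈ span ℝ {φ y', ψ y'} → q y = q y') :
    Nonempty (integralPlanes F w ≃ₜ X) := by
  let f : Y → Fin 2 → Jet2 := fun y i => Ψ.toJet (![φ y, ψ y] i)
  have hf : ∀ y, LinearIndependent ℝ (f y) := fun y =>
    (hli y).map' Ψ.toJet (LinearMap.ker_eq_bot.2 Ψ.injective)
  have hrange : ∀ y, span ℝ (range (f y)) = (span ℝ {φ y, ψ y}).map Ψ.toJet := by
    intro y
    have : f y = Ψ.toJet ∘ ![φ y, ψ y] := rfl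
    rw [this, range_comp, span_image, Matrix.range_cons_cons_empty]
  have hfc : Continuous f := by
    refine continuous_pi fun i => Ψ.toJet.continuous_of_finiteDimensional.comp ?_
    fin_cases i
    · exact hφ
    · exact hψ
  refine nonempty_homeomorph_of_frames hq hfc hf (fun v => ⟨?_, ?_⟩) fun y y' => ?_
  · rintro ⟨hvD, hv1, hv2⟩
    obtain ⟨⟨g, hg⟩, rfl⟩ := surjective_frameSpan 2 Jet2 v
    have hgm : ∀ i, g i ∈ span ℝ (range g) := fun i => subset_span (mem_range_self i)
    obtain ⟨m, hm, hm0⟩ := (Ψ.mem_iff _).1 (hvD (hgm 0))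
    obtain ⟨m', hm', hm1⟩ := (Ψ.mem_iff _).1 (hvD (hgm 1))
    obtain ⟨y, hy, hy'⟩ := hex m m' hm hm' ((Ψ.integral_iff m m').1 (by
      rw [hm0, hm1]
      exact ⟨hv1 _ (hgm 0) _ (hgm 1), hv2 _ (hgm 0) _ (hgm 1)⟩))
    refine ⟨y, Subtype.ext (eq_of_le_of_finrank_eq ?_ ?_).symm⟩
    · refine span_le.2 ?_
      rintro _ ⟨i, rfl⟩
      rw [SetLike.mem_coe]
      change g i ∈ span ℝ (range (f y))
      rw [hrange]
      fin_cases i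
      · exact ⟨m, hy, hm0⟩
      · exact ⟨m', hy', hm1⟩
    · exact (frameSpan 2 Jet2 _).2.trans (frameSpan 2 Jet2 _).2.symm
  · rintro ⟨y, rfl⟩
    have hmem : ∀ x ∈ span ℝ (range (f y)), ∃ m ∈ span ℝ {φ y, ψ y}, Ψ.toJet m = x := by
      intro x hx
      rwa [hrange] at hx
    have hform : ∀ x ∈ span ℝ (range (f y)), ∀ x' ∈ span ℝ (range (f y)),
        extDeriv (contactForm 1) w ![x, x'] = 0 ∧ extDeriv (contactForm 2) w ![x, x'] = 0 := by
      intro x hx x' hx'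
      obtain ⟨m, hm, rfl⟩ := hmem x hx
      obtain ⟨m', hm', rfl⟩ := hmem x' hx'
      exact (Ψ.integral_iff m m').2 ((hint y).of_mem_span hm hm')
    refine ⟨?_, fun x hx x' hx' => (hform x hx x' hx').1, fun x hx x' hx' => (hform x hx x' hx').2⟩
    refine span_le.2 ?_
    rintro _ ⟨i, rfl⟩
    rw [SetLike.mem_coe, Ψ.mem_iff]
    fin_cases i
    · exact ⟨φ y, hφD y, rfl⟩
    · exact ⟨ψ y, hψD y, rfl⟩
  · rw [hrange, hrange, (map_injective_of_injective Ψ.injective).eq_iff]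
    constructor
    · intro h
      refine hinj y y' ?_ ?_
      · exact h ▸ subset_span (by simp)
      · exact h ▸ subset_span (by simp)
    · intro h
      refine le_antisymm (span_le.2 ?_) (span_le.2 ?_)
      · rintro _ (rfl | rfl)
        · exact (hspan y y' h).1
        · exact (hspan y y' h).2
      · rintro _ (rfl | rfl)
        · exact (hspan y' y h.symm).1
        · exact (hspan y' y h.symm).2

theorem isQuotientMap_of_compactSpace {X Y : Type*} [TopologicalSpace X] [TopologicalSpace Y]
    [CompactSpace X] [T2Space Y] {f : X → Y} (hf : Continuous f) (hs : Function.Surjective f) :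
    IsQuotientMap f :=
  hf.isClosedMap.isQuotientMap hf hs

theorem exists_smul_sphere {E : Type*} [NormedAddCommGroup E] [NormedSpace ℝ E] [Nontrivial E]
    (x : E) : ∃ y : Metric.sphere (0 : E) 1, ∃ r : ℝ, x = r • (y : E) := by
  by_cases hx : x = 0
  · obtain ⟨y, hy⟩ := NormedSpace.sphere_nonempty (x := (0 : E)) (r := 1) |>.2 zero_le_one
    exact ⟨⟨y, hy⟩, 0, by simp [hx]⟩
  · refine ⟨⟨‖x‖⁻¹ • x, by simp [norm_smul, hx]⟩, ‖x‖, ?_⟩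
    simp [smul_smul, hx]

/-! ### Lines in the plane -/

/-- Two vectors of the plane with zero determinant lie on a common line. -/
theorem exists_circle_line {a b c d : ℝ} (h : a * d = b * c) : ∃ (z : Circle) (s t : ℝ),
    a = s * (z : ℂ).re ∧ b = s * (z : ℂ).im ∧ c = t * (z : ℂ).re ∧ d = t * (z : ℂ).im := by
  have key : ∀ a b : ℝ, ∃ (z : Circle) (s : ℝ), a = s * (z : ℂ).re ∧ b = s * (z : ℂ).im := by
    intro a b
    obtain ⟨⟨z, hz⟩, s, h⟩ := exists_smul_sphere (⟨a, b⟩ : ℂ)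
    refine ⟨⟨z, by simpa [Submonoid.unitSphere] using hz⟩, s, ?_, ?_⟩
    · simpa using congrArg Complex.re h
    · simpa using congrArg Complex.im h
  obtain ⟨z, s, ha, hb⟩ := key a b
  by_cases hs : s = 0
  · obtain ⟨z', t, hc, hd⟩ := key c d
    exact ⟨z', 0, t, by simp [ha, hs], by simp [hb, hs], hc, hd⟩
  · have h1 := circle_re_sq_add_im_sq z
    have h2 : (z : ℂ).re * d = (z : ℂ).im * c := by
      rw [ha, hb] at h
      exact mul_left_cancel₀ hs (by linarith)
    refine ⟨z, s, c * (z : ℂ).re + d * (z : ℂ).im, ha, hb, ?_, ?_⟩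
    · linear_combination -c * h1 - (z : ℂ).im * h2
    · linear_combination -d * h1 + (z : ℂ).re * h2

/-- Squaring identifies the unit vectors that span the same line. -/
theorem circle_sq_eq_sq_iff (z z' : Circle) :
    z ^ 2 = z' ^ 2 ↔ (z : ℂ).re * (z' : ℂ).im = (z : ℂ).im * (z' : ℂ).re := by
  have h1 := circle_re_sq_add_im_sq z
  have h2 := circle_re_sq_add_im_sq z'
  rw [Circle.ext_iff, Complex.ext_iff]
  simp only [pow_two, Circle.coe_mul, Complex.mul_re, Complex.mul_im]
  generalize (z : ℂ).re = x at *
  generalize (z : ℂ).im = y at *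
  generalize (z' : ℂ).re = x' at *
  generalize (z' : ℂ).im = y' at *
  constructor
  · rintro ⟨h3, h4⟩
    have hx : x ^ 2 = x' ^ 2 := by linarith
    have hy : y ^ 2 = y' ^ 2 := by linarith
    have hxy : x * y = x' * y' := by linarith
    have : (x * y' - y * x') ^ 2 = 0 := by
      linear_combination -x ^ 2 * hy - y ^ 2 * hx + 2 * x * y * hxy
    exact sub_eq_zero.1 (pow_eq_zero_iff two_ne_zero |>.1 this)
  · intro h
    have hx : x = (x * x' + y * y') * x' := by linear_combination -x * h2 + y' * h
    have hy : y = (x * x' + y * y') * y' := by linear_combination -y * h2 - x' * h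
    have hc : (x * x' + y * y') ^ 2 = 1 := by
      linear_combination (x' ^ 2 + y' ^ 2) * h1 + h2 - (x * y' - y * x') * h
    generalize x * x' + y * y' = c at hx hy hc
    subst hx hy
    exact ⟨by linear_combination (x' * x' - y' * y') * hc,
      by linear_combination 2 * (x' * y') * hc⟩

theorem circle_eq_or_eq_neg_of_sq_eq_sq {z z' : Circle} (h : z ^ 2 = z' ^ 2) :
    ((z : ℂ).re = (z' : ℂ).re ∧ (z : ℂ).im = (z' : ℂ).im) ∨
      ((z : ℂ).re = -(z' : ℂ).re ∧ (z : ℂ).im = -(z' : ℂ).im) := by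
  have h' : (z : ℂ) ^ 2 = (z' : ℂ) ^ 2 := by exact_mod_cast congrArg (Subtype.val) h
  rcases sq_eq_sq_iff_eq_or_eq_neg.1 h' with h | h
  · simp [h]
  · simp [h]

theorem surjective_circle_sq : Function.Surjective fun z : Circle => z ^ 2 := by
  intro z
  obtain ⟨t, rfl⟩ := Circle.exp_surjective z
  refine ⟨Circle.exp (t / 2), ?_⟩
  simp only [pow_two]
  rw [← Circle.exp_add, add_halves]

end SecondOrderPDE

namespace SecondOrderPDE

open Set Filter Topology Module Submodule

/-! ### The three normal forms -/

theorem mem_span_pair_fin_five {m φ ψ : Fin 5 → ℝ} : m ∈ span ℝ {φ, ψ} ↔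
    ∃ s t : ℝ, m 0 = s * φ 0 + t * ψ 0 ∧ m 1 = s * φ 1 + t * ψ 1 ∧ m 2 = s * φ 2 + t * ψ 2 ∧
      m 3 = s * φ 3 + t * ψ 3 ∧ m 4 = s * φ 4 + t * ψ 4 := by
  rw [mem_span_pair]
  refine exists_congr fun s => exists_congr fun t => ?_
  rw [funext_iff, Fin.forall_fin_succ, Fin.forall_fin_succ, Fin.forall_fin_succ,
    Fin.forall_fin_succ, Fin.forall_fin_one]
  simp only [Pi.add_apply, Pi.smul_apply, smul_eq_mul]
  constructor <;> rintro ⟨h0, h1, h2, h3, h4⟩ <;>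
    exact ⟨h0.symm, h1.symm, h2.symm, h3.symm, h4.symm⟩

theorem linearIndependent_pair_fin_five {φ ψ : Fin 5 → ℝ}
    (h : ∀ s t : ℝ, (∀ i, s * φ i + t * ψ i = 0) → s = 0 ∧ t = 0) :
    LinearIndependent ℝ ![φ, ψ] := by
  rw [LinearIndependent.pair_iff]
  intro s t hst
  exact h s t fun i => congrFun hst i

theorem continuous_vec_five {Y : Type*} [TopologicalSpace Y] {a b c d e : Y → ℝ}
    (ha : Continuous a) (hb : Continuous b) (hc : Continuous c) (hd : Continuous d)
    (he : Continuous e) : Continuous fun y => ![a y, b y, c y, d y, e y] := by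
  refine continuous_pi fun i => ?_
  fin_cases i <;> assumption

/-- When `S = 0` the two equations separate into the pairs `(α, P)` and `(β, T)`: an integral
plane is the sum of a line in the `(α, P)`-plane and a line in the `(β, T)`-plane. -/
theorem AdaptedCoords.nonempty_homeomorph_torus {F : Jet2 → ℝ} {w : Jet2} {b : ℝ} (hb : b ≠ 0)
    (Ψ : AdaptedCoords F w 0 b 0) : Nonempty (integralPlanes F w ≃ₜ Torus) := by
  have hq : IsQuotientMap fun y : Torus => ((y.1 ^ 2, y.2 ^ 2) : Torus) :=
    isQuotientMap_of_compactSpace (by fun_prop)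
      (surjective_circle_sq.prodMap surjective_circle_sq)
  have h1 : Continuous fun y : Torus => (y.1 : ℂ).re := by fun_prop
  have h2 : Continuous fun y : Torus => (y.1 : ℂ).im := by fun_prop
  have h3 : Continuous fun y : Torus => (y.2 : ℂ).re := by fun_prop
  have h4 : Continuous fun y : Torus => (y.2 : ℂ).im := by fun_prop
  refine Ψ.nonempty_homeomorph hq
    (φ := fun y => ![(y.1 : ℂ).re, 0, (y.1 : ℂ).im, 0, 0])
    (ψ := fun y => ![0, (y.2 : ℂ).re, 0, 0, (y.2 : ℂ).im])
    (continuous_vec_five h1 continuous_const h2 continuous_const continuous_const)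
    (continuous_vec_five continuous_const h3 continuous_const continuous_const h4)
    (fun y => linearIndependent_pair_fin_five fun s t h => ?_) (fun y => by simp)
    (fun y => by simp) (fun y => by simp [ModelIntegral]) ?_ ?_ ?_
  · have e0 : s * (y.1 : ℂ).re = 0 := by simpa using h 0
    have e1 : t * (y.2 : ℂ).re = 0 := by simpa using h 1
    have e2 : s * (y.1 : ℂ).im = 0 := by simpa using h 2
    have e4 : t * (y.2 : ℂ).im = 0 := by simpa using h 4
    have n1 := circle_re_sq_add_im_sq y.1
    have n2 := circle_re_sq_add_im_sq y.2
    constructor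
    · linear_combination (y.1 : ℂ).re * e0 + (y.1 : ℂ).im * e2 - s * n1
    · linear_combination (y.2 : ℂ).re * e1 + (y.2 : ℂ).im * e4 - t * n2
  · intro m m' hm hm' ⟨h1, h2⟩
    have hS : m 3 = 0 := by simpa [hb] using hm
    have hS' : m' 3 = 0 := by simpa [hb] using hm'
    rw [hS, hS'] at h1 h2
    obtain ⟨z, s, t, hz⟩ := exists_circle_line (a := m 0) (b := m 2) (c := m' 0) (d := m' 2)
      (by linarith)
    obtain ⟨z', s', t', hz'⟩ := exists_circle_line (a := m 1) (b := m 4) (c := m' 1) (d := m' 4)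
      (by linarith)
    refine ⟨(z, z'), mem_span_pair_fin_five.2 ⟨s, s', ?_⟩, mem_span_pair_fin_five.2 ⟨t, t', ?_⟩⟩
    · simpa [hS] using ⟨hz.1, hz'.1, hz.2.1, hz'.2.1⟩
    · simpa [hS'] using ⟨hz.2.2.1, hz'.2.2.1, hz.2.2.2, hz'.2.2.2⟩
  · intro y y' h
    obtain ⟨h1, h2⟩ := Prod.ext_iff.1 h
    constructor
    · rw [mem_span_pair_fin_five]
      rcases circle_eq_or_eq_neg_of_sq_eq_sq h1 with h | h
      · exact ⟨1, 0, by simp [h]⟩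
      · exact ⟨-1, 0, by simp [h]⟩
    · rw [mem_span_pair_fin_five]
      rcases circle_eq_or_eq_neg_of_sq_eq_sq h2 with h | h
      · exact ⟨0, 1, by simp [h]⟩
      · exact ⟨0, -1, by simp [h]⟩
  · intro y y' h1 h2
    obtain ⟨s, t, h1⟩ := mem_span_pair_fin_five.1 h1
    obtain ⟨s', t', h2⟩ := mem_span_pair_fin_five.1 h2
    simp at h1 h2
    refine Prod.ext ((circle_sq_eq_sq_iff _ _).2 ?_) ((circle_sq_eq_sq_iff _ _).2 ?_)
    · rw [h1.1, h1.2.2.1]; ring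
    · rw [h2.2.1, h2.2.2.2]; ring

/-- The Hopf map, in real coordinates of `(y₀ + i y₁, y₂ + i y₃)`. -/
def hopf (y : EuclideanSpace ℝ (Fin 4)) : EuclideanSpace ℝ (Fin 3) :=
  !₂[2 * (y 0 * y 2 + y 1 * y 3), 2 * (y 1 * y 2 - y 0 * y 3),
    y 0 ^ 2 + y 1 ^ 2 - y 2 ^ 2 - y 3 ^ 2]

theorem sphere_sum_sq (y : Metric.sphere (0 : EuclideanSpace ℝ (Fin 4)) 1) :
    y.1 0 ^ 2 + y.1 1 ^ 2 + y.1 2 ^ 2 + y.1 3 ^ 2 = 1 := by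
  have h := mem_sphere_zero_iff_norm.1 y.2
  have h2 := EuclideanSpace.real_norm_sq_eq y.1
  rw [h, Fin.sum_univ_four] at h2
  linarith

theorem hopf_mem_sphere (y : Metric.sphere (0 : EuclideanSpace ℝ (Fin 4)) 1) :
    hopf y.1 ∈ Metric.sphere (0 : EuclideanSpace ℝ (Fin 3)) 1 := by
  rw [mem_sphere_zero_iff_norm, ← pow_eq_one_iff_of_nonneg (norm_nonneg _) two_ne_zero,
    EuclideanSpace.real_norm_sq_eq, Fin.sum_univ_three]
  have h := sphere_sum_sq y
  simp [hopf]
  linear_combination (y.1 0 ^ 2 + y.1 1 ^ 2 + y.1 2 ^ 2 + y.1 3 ^ 2 + 1) * h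

/-- The Hopf map `S³ → S²`, whose fibres are the unit circles of the complex lines of `ℂ²`. -/
def hopfSphere (y : Metric.sphere (0 : EuclideanSpace ℝ (Fin 4)) 1) : Sphere2 :=
  ⟨hopf y.1, hopf_mem_sphere y⟩

theorem continuous_hopfSphere : Continuous hopfSphere := by
  refine Continuous.subtype_mk ?_ _
  refine (PiLp.continuous_toLp 2 _).comp (continuous_pi fun i => ?_)
  fin_cases i <;> simp <;> fun_prop

theorem surjective_hopfSphere : Function.Surjective hopfSphere := by
  rintro ⟨x, hx⟩
  have hx2 : x 0 ^ 2 + x 1 ^ 2 + x 2 ^ 2 = 1 := by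
    have h2 := EuclideanSpace.real_norm_sq_eq x
    rw [mem_sphere_zero_iff_norm.1 hx, Fin.sum_univ_three] at h2
    linarith
  suffices ∃ a b c d : ℝ, a ^ 2 + b ^ 2 + c ^ 2 + d ^ 2 = 1 ∧ 2 * (a * c + b * d) = x 0 ∧
      2 * (b * c - a * d) = x 1 ∧ a ^ 2 + b ^ 2 - c ^ 2 - d ^ 2 = x 2 by
    obtain ⟨a, b, c, d, h, h0, h1, h2⟩ := this
    refine ⟨⟨!₂[a, b, c, d], ?_⟩, Subtype.ext ?_⟩
    · rw [mem_sphere_zero_iff_norm, ← pow_eq_one_iff_of_nonneg (norm_nonneg _) two_ne_zero,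
        EuclideanSpace.real_norm_sq_eq, Fin.sum_univ_four]
      simpa using h
    · ext i
      fin_cases i
      · simpa [hopfSphere, hopf] using h0
      · simpa [hopfSphere, hopf] using h1
      · simpa [hopfSphere, hopf] using h2
  generalize x 0 = a at *
  generalize x 1 = b at *
  generalize x 2 = c at *
  by_cases hc : c = -1
  · subst hc
    have ha : a = 0 := by nlinarith
    have hb : b = 0 := by nlinarith
    exact ⟨0, 0, 1, 0, by norm_num, by simp [ha], by simp [hb], by norm_num⟩
  · have hc1 : 0 < (1 + c) / 2 := by
      have : -1 ≤ c := by nlinarith [sq_nonneg a, sq_nonneg b]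
      have := lt_of_le_of_ne this (Ne.symm hc)
      linarith
    obtain ⟨r, hr, hr2⟩ : ∃ r : ℝ, r ≠ 0 ∧ r ^ 2 = (1 + c) / 2 :=
      ⟨√((1 + c) / 2), (Real.sqrt_pos.2 hc1).ne', Real.sq_sqrt hc1.le⟩
    have hcr : c = 2 * r ^ 2 - 1 := by linarith
    subst hcr
    refine ⟨r, 0, a / (2 * r), -b / (2 * r), ?_, ?_, ?_, ?_⟩
    · field_simp
      linear_combination hx2
    · field_simp; ring
    · field_simp; ring
    · field_simp
      linear_combination -hx2

/-- When `T = -P` the two equations are the real and imaginary part of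
`(P - i S) (α' + i β') = (P' - i S') (α + i β)`, so that the integral planes are the complex lines
of `ℂ²`. -/
theorem AdaptedCoords.nonempty_homeomorph_sphere {F : Jet2 → ℝ} {w : Jet2} {a : ℝ} (ha : a ≠ 0)
    (Ψ : AdaptedCoords F w a 0 a) : Nonempty (integralPlanes F w ≃ₜ Sphere2) := by
  have hq := isQuotientMap_of_compactSpace continuous_hopfSphere surjective_hopfSphere
  have hc : ∀ i, Continuous fun y : Metric.sphere (0 : EuclideanSpace ℝ (Fin 4)) 1 => y.1 i :=
    fun i => by fun_prop
  refine Ψ.nonempty_homeomorph hq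
    (φ := fun y => ![y.1 0, y.1 1, y.1 2, -y.1 3, -y.1 2])
    (ψ := fun y => ![-y.1 1, y.1 0, -y.1 3, -y.1 2, y.1 3])
    (continuous_vec_five (hc 0) (hc 1) (hc 2) (hc 3).neg (hc 2).neg)
    (continuous_vec_five (hc 1).neg (hc 0) (hc 3).neg (hc 2).neg (hc 3))
    (fun y => linearIndependent_pair_fin_five fun s t h => ?_) (fun y => by simp)
    (fun y => by simp) (fun y => ?_) ?_ ?_ ?_
  · have e0 : s * y.1 0 + t * (-y.1 1) = 0 := by simpa using h 0
    have e1 : s * y.1 1 + t * y.1 0 = 0 := by simpa using h 1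
    have e2 : s * y.1 2 + t * (-y.1 3) = 0 := by simpa using h 2
    have e3 : s * (-y.1 3) + t * (-y.1 2) = 0 := by simpa using h 3
    have n := sphere_sum_sq y
    constructor
    · linear_combination y.1 0 * e0 + y.1 1 * e1 + y.1 2 * e2 - y.1 3 * e3 - s * n
    · linear_combination -y.1 1 * e0 + y.1 0 * e1 - y.1 3 * e2 - y.1 2 * e3 - t * n
  · simp [ModelIntegral]
  · intro m m' hm hm' ⟨h1, h2⟩
    have hT : ∀ m : Fin 5 → ℝ, a * m 2 + 0 * m 3 + a * m 4 = 0 → m 4 = -m 2 := by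
      intro m hm
      exact mul_left_cancel₀ ha (by linarith)
    -- the point of `ℂ²` with coordinates `m` lies on the line through some unit vector
    have key : ∀ m : Fin 5 → ℝ, ∃ (y : Metric.sphere (0 : EuclideanSpace ℝ (Fin 4)) 1) (r : ℝ),
        m 0 = r * y.1 0 ∧ m 1 = r * y.1 1 ∧ m 2 = r * y.1 2 ∧ m 3 = r * (-y.1 3) := by
      intro m
      obtain ⟨y, r, h⟩ := exists_smul_sphere !₂[m 0, m 1, m 2, -m 3]
      have h' := fun i => congrArg (fun v : EuclideanSpace ℝ (Fin 4) => v i) h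
      refine ⟨y, r, by simpa using h' 0, by simpa using h' 1, by simpa using h' 2, ?_⟩
      have : -m 3 = r * y.1 3 := by simpa using h' 3
      linarith
    have hT1 := hT m hm
    have hT2 := hT m' hm'
    obtain ⟨y, r, y0, y1, y2, y3⟩ := key m
    by_cases hr : r = 0
    · obtain ⟨y', r', y0', y1', y2', y3'⟩ := key m'
      refine ⟨y', mem_span_pair_fin_five.2 ⟨0, 0, ?_⟩, mem_span_pair_fin_five.2 ⟨r', 0, ?_⟩⟩
      · simp [hT1, y0, y1, y2, y3, hr]
      · simp [hT2, y0', y1', y2', y3']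
    · have n := sphere_sum_sq y
      rw [y0, y1, y2, y3] at h1
      rw [hT1, hT2, y0, y1, y2, y3] at h2
      have h1' : y.1 2 * m' 0 - y.1 3 * m' 1 - m' 2 * y.1 0 - m' 3 * y.1 1 = 0 :=
        mul_left_cancel₀ hr (by linarith)
      have h2' : -y.1 3 * m' 0 - y.1 2 * m' 1 - m' 3 * y.1 0 + m' 2 * y.1 1 = 0 :=
        mul_left_cancel₀ hr (by linarith)
      refine ⟨y, mem_span_pair_fin_five.2 ⟨r, 0, ?_⟩, mem_span_pair_fin_five.2
        ⟨y.1 0 * m' 0 + y.1 1 * m' 1 + y.1 2 * m' 2 - y.1 3 * m' 3,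
          -y.1 1 * m' 0 + y.1 0 * m' 1 - y.1 3 * m' 2 - y.1 2 * m' 3, ?_⟩⟩
      · simp [hT1, y0, y1, y2, y3]
      · simp [hT2]
        refine ⟨?_, ?_, ?_, ?_, ?_⟩
        · linear_combination -m' 0 * n + y.1 2 * h1' - y.1 3 * h2'
        · linear_combination -m' 1 * n - y.1 3 * h1' - y.1 2 * h2'
        · linear_combination -m' 2 * n - y.1 0 * h1' + y.1 1 * h2'
        · linear_combination -m' 3 * n - y.1 1 * h1' - y.1 0 * h2'
        · linear_combination m' 2 * n + y.1 0 * h1' - y.1 1 * h2'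
  · intro y y' h
    have h' := fun i => congrArg (fun v : Sphere2 => v.1 i) h
    have e0 : y.1 0 * y.1 2 + y.1 1 * y.1 3 = y'.1 0 * y'.1 2 + y'.1 1 * y'.1 3 := by
      simpa [hopfSphere, hopf] using h' 0
    have e1 : y.1 1 * y.1 2 - y.1 0 * y.1 3 = y'.1 1 * y'.1 2 - y'.1 0 * y'.1 3 := by
      simpa [hopfSphere, hopf] using h' 1
    have e2 : y.1 0 ^ 2 + y.1 1 ^ 2 - y.1 2 ^ 2 - y.1 3 ^ 2 =
        y'.1 0 ^ 2 + y'.1 1 ^ 2 - y'.1 2 ^ 2 - y'.1 3 ^ 2 := by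
      simpa [hopfSphere, hopf] using h' 2
    have n := sphere_sum_sq y
    have n' := sphere_sum_sq y'
    generalize y.1 0 = x₀ at *
    generalize y.1 1 = x₁ at *
    generalize y.1 2 = x₂ at *
    generalize y.1 3 = x₃ at *
    generalize y'.1 0 = y₀ at *
    generalize y'.1 1 = y₁ at *
    generalize y'.1 2 = y₂ at *
    generalize y'.1 3 = y₃ at *
    have hA : x₀ ^ 2 + x₁ ^ 2 = y₀ ^ 2 + y₁ ^ 2 := by linarith
    have hB : x₂ ^ 2 + x₃ ^ 2 = y₂ ^ 2 + y₃ ^ 2 := by linarith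
    -- the complex determinant of the two points of `ℂ²` vanishes
    have hdet : (x₀ * y₂ - x₁ * y₃ - (x₂ * y₀ - x₃ * y₁)) ^ 2 +
        (x₀ * y₃ + x₁ * y₂ - (x₂ * y₁ + x₃ * y₀)) ^ 2 = 0 := by
      linear_combination -(x₀ ^ 2 + x₁ ^ 2) * hB - (x₂ ^ 2 + x₃ ^ 2) * hA +
        2 * (x₀ * x₂ + x₁ * x₃) * e0 + 2 * (x₁ * x₂ - x₀ * x₃) * e1
    have d1 : x₀ * y₂ - x₁ * y₃ - (x₂ * y₀ - x₃ * y₁) = 0 := by nlinarith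
    have d2 : x₀ * y₃ + x₁ * y₂ - (x₂ * y₁ + x₃ * y₀) = 0 := by nlinarith
    constructor
    · refine mem_span_pair_fin_five.2 ⟨y₀ * x₀ + y₁ * x₁ + y₂ * x₂ + y₃ * x₃,
        y₀ * x₁ - y₁ * x₀ + y₂ * x₃ - y₃ * x₂, ?_⟩
      simp
      refine ⟨?_, ?_, ?_, ?_, ?_⟩
      · linear_combination -x₀ * n' + y₂ * d1 + y₃ * d2
      · linear_combination -x₁ * n' - y₃ * d1 + y₂ * d2
      · linear_combination -x₂ * n' - y₀ * d1 - y₁ * d2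
      · linear_combination x₃ * n' - y₁ * d1 + y₀ * d2
      · linear_combination x₂ * n' + y₀ * d1 + y₁ * d2
    · refine mem_span_pair_fin_five.2 ⟨-(y₀ * x₁ - y₁ * x₀ + y₂ * x₃ - y₃ * x₂),
        y₀ * x₀ + y₁ * x₁ + y₂ * x₂ + y₃ * x₃, ?_⟩
      simp
      refine ⟨?_, ?_, ?_, ?_, ?_⟩
      · linear_combination x₁ * n' + y₃ * d1 - y₂ * d2
      · linear_combination -x₀ * n' + y₂ * d1 + y₃ * d2
      · linear_combination x₃ * n' - y₁ * d1 + y₀ * d2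
      · linear_combination x₂ * n' + y₀ * d1 + y₁ * d2
      · linear_combination -x₃ * n' + y₁ * d1 - y₀ * d2
  · intro y y' h _
    obtain ⟨s, t, h0, h1, h2, h3, -⟩ := mem_span_pair_fin_five.1 h
    simp at h0 h1 h2 h3
    have h3' : y.1 3 = s * y'.1 3 + t * y'.1 2 := by linarith
    have n := sphere_sum_sq y
    have n' := sphere_sum_sq y'
    have hst : s ^ 2 + t ^ 2 = 1 := by
      rw [h0, h1, h2, h3'] at n
      linear_combination n - (s ^ 2 + t ^ 2) * n'
    refine Subtype.ext ?_
    ext i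
    fin_cases i <;> simp [hopfSphere, hopf, h0, h1, h2, h3']
    · linear_combination (y'.1 0 * y'.1 2 + y'.1 1 * y'.1 3) * hst
    · linear_combination (y'.1 1 * y'.1 2 - y'.1 0 * y'.1 3) * hst
    · linear_combination (y'.1 0 ^ 2 + y'.1 1 ^ 2 - y'.1 2 ^ 2 - y'.1 3 ^ 2) * hst

/-- When `T = 0` the first equation says that the `(α, S)`-parts of an integral plane lie on a
line `l`. A plane with nonzero `(α, S)`-part is spanned by `(l; c l⊥)` and `(0; l)`, with the
pairs `(α, S)` and `(β, P)` listed in this order; as `c` tends to infinity, all these planes tend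
to the one plane `α = S = 0`. Writing `c = t / s` with `(s, t)` on the unit circle gives a family
of frames over `S¹ × S¹` whose circle `s = 0` is collapsed. -/
theorem AdaptedCoords.nonempty_homeomorph_pinchedTorus {F : Jet2 → ℝ} {w : Jet2} {c : ℝ}
    (hc : c ≠ 0) (Ψ : AdaptedCoords F w 0 0 c) :
    Nonempty (integralPlanes F w ≃ₜ PinchedTorus) := by
  have hq : IsQuotientMap fun y : Torus => (Quotient.mk pinchSetoid (y.2 ^ 2, y.1 ^ 2)) := by
    have h1 : IsQuotientMap fun y : Torus => ((y.2 ^ 2, y.1 ^ 2) : Torus) :=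
      isQuotientMap_of_compactSpace (by fun_prop)
        ((surjective_circle_sq.prodMap surjective_circle_sq).comp Prod.swap_surjective)
    exact isQuotientMap_quot_mk.comp h1
  have h1 : Continuous fun y : Torus => (y.1 : ℂ).re := by fun_prop
  have h2 : Continuous fun y : Torus => (y.1 : ℂ).im := by fun_prop
  have h3 : Continuous fun y : Torus => (y.2 : ℂ).re := by fun_prop
  have h4 : Continuous fun y : Torus => (y.2 : ℂ).im := by fun_prop
  have hsq : ∀ z : Circle, z ^ 2 = 1 ↔ (z : ℂ).im = 0 := by
    intro z
    have := circle_sq_eq_sq_iff z 1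
    simpa [eq_comm] using this
  refine Ψ.nonempty_homeomorph hq
    (φ := fun y => ![(y.2 : ℂ).im * (y.1 : ℂ).re, -((y.2 : ℂ).re * (y.1 : ℂ).im),
      (y.2 : ℂ).re * (y.1 : ℂ).re, (y.2 : ℂ).im * (y.1 : ℂ).im, 0])
    (ψ := fun y => ![0, (y.1 : ℂ).re, (y.1 : ℂ).im, 0, 0])
    (continuous_vec_five (h4.mul h1) (h3.mul h2).neg (h3.mul h1) (h4.mul h2) continuous_const)
    (continuous_vec_five continuous_const h1 h2 continuous_const continuous_const)
    (fun y => linearIndependent_pair_fin_five fun a b h => ?_) (fun y => by simp)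
    (fun y => by simp) (fun y => ?_) ?_ ?_ ?_
  · have e0 : a * ((y.2 : ℂ).im * (y.1 : ℂ).re) = 0 := by simpa using h 0
    have e1 : a * (-((y.2 : ℂ).re * (y.1 : ℂ).im)) + b * (y.1 : ℂ).re = 0 := by simpa using h 1
    have e2 : a * ((y.2 : ℂ).re * (y.1 : ℂ).re) + b * (y.1 : ℂ).im = 0 := by simpa using h 2
    have e3 : a * ((y.2 : ℂ).im * (y.1 : ℂ).im) = 0 := by simpa using h 3
    have n1 := circle_re_sq_add_im_sq y.1
    have n2 := circle_re_sq_add_im_sq y.2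
    generalize (y.1 : ℂ).re = x at *
    generalize (y.1 : ℂ).im = z at *
    generalize (y.2 : ℂ).re = t at *
    generalize (y.2 : ℂ).im = s at *
    constructor
    · linear_combination s * x * e0 + s * z * e3 + t * x * e2 - t * z * e1 - a * n2 -
        a * (s ^ 2 + t ^ 2) * n1
    · linear_combination x * e1 + z * e2 - b * n1
  · simp [ModelIntegral]
    ring
  · intro m m' hm hm' ⟨h1, h2⟩
    have hT : m 4 = 0 := by simpa [hc] using hm
    have hT' : m' 4 = 0 := by simpa [hc] using hm'
    rw [hT, hT'] at h2
    obtain ⟨l, d, d', e0, e3, e0', e3'⟩ := exists_circle_line (a := m 0) (b := m 3)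
      (c := m' 0) (d := m' 3) (by linarith)
    rw [e0, e3, e0', e3'] at h1
    obtain ⟨u, r, r', f0, f1, f0', f1'⟩ := exists_circle_line
      (a := m 2 * (l : ℂ).re - m 1 * (l : ℂ).im) (b := d)
      (c := m' 2 * (l : ℂ).re - m' 1 * (l : ℂ).im) (d := d') (by linarith)
    have n := circle_re_sq_add_im_sq l
    refine ⟨(l, u),
      mem_span_pair_fin_five.2 ⟨r, m 1 * (l : ℂ).re + m 2 * (l : ℂ).im, ?_⟩,
      mem_span_pair_fin_five.2 ⟨r', m' 1 * (l : ℂ).re + m' 2 * (l : ℂ).im, ?_⟩⟩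
    · simp [hT, e0, e3]
      refine ⟨?_, ?_, ?_, ?_⟩
      · rw [f1]; ring
      · linear_combination -(l : ℂ).im * f0 - m 1 * n
      · linear_combination (l : ℂ).re * f0 - m 2 * n
      · rw [f1]; ring
    · simp [hT', e0', e3']
      refine ⟨?_, ?_, ?_, ?_⟩
      · rw [f1']; ring
      · linear_combination -(l : ℂ).im * f0' - m' 1 * n
      · linear_combination (l : ℂ).re * f0' - m' 2 * n
      · rw [f1']; ring
  · intro y y' h
    rcases Quotient.exact h with h | ⟨h2, h2'⟩
    · obtain ⟨h2, h1⟩ := Prod.ext_iff.1 h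
      rw [mem_span_pair_fin_five, mem_span_pair_fin_five]
      rcases circle_eq_or_eq_neg_of_sq_eq_sq h1 with h1 | h1 <;>
      rcases circle_eq_or_eq_neg_of_sq_eq_sq h2 with h2 | h2
      · exact ⟨⟨1, 0, by simp [h1, h2]⟩, ⟨0, 1, by simp [h1]⟩⟩
      · exact ⟨⟨-1, 0, by simp [h1, h2]⟩, ⟨0, 1, by simp [h1]⟩⟩
      · exact ⟨⟨-1, 0, by simp [h1, h2]⟩, ⟨0, -1, by simp [h1]⟩⟩
      · exact ⟨⟨1, 0, by simp [h1, h2]⟩, ⟨0, -1, by simp [h1]⟩⟩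
    · -- both frames span the plane `α = S = 0`
      have hs : (y.2 : ℂ).im = 0 := (hsq _).1 h2
      have hs' : (y'.2 : ℂ).im = 0 := (hsq _).1 h2'
      have n' := circle_re_sq_add_im_sq y'.1
      have n2' := circle_re_sq_add_im_sq y'.2
      rw [hs'] at n2'
      rw [mem_span_pair_fin_five, mem_span_pair_fin_five]
      generalize (y.1 : ℂ).re = x at *
      generalize (y.1 : ℂ).im = z at *
      generalize (y.2 : ℂ).re = t at *
      generalize (y'.1 : ℂ).re = x' at *
      generalize (y'.1 : ℂ).im = z' at *
      generalize (y'.2 : ℂ).re = t' at *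
      constructor
      · refine ⟨t * t' * (x * x' + z * z'), t * (x * z' - z * x'), ?_⟩
        simp [hs, hs']
        constructor
        · linear_combination t * z' * (x * x' + z * z') * n2' + t * z * n'
        · linear_combination -t * x' * (x * x' + z * z') * n2' - t * x * n'
      · refine ⟨t' * (z * x' - x * z'), x * x' + z * z', ?_⟩
        simp [hs']
        constructor
        · linear_combination z' * (z * x' - x * z') * n2' - x * n'
        · linear_combination -x' * (z * x' - x * z') * n2' - z * n'
  · intro y y' h h'
    obtain ⟨a, b, h⟩ := mem_span_pair_fin_five.1 h
    obtain ⟨a', b', h'⟩ := mem_span_pair_fin_five.1 h'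
    simp at h h'
    obtain ⟨h0, h1, h2, h3⟩ := h
    obtain ⟨k0, k1, k2, k3⟩ := h'
    have n := circle_re_sq_add_im_sq y.1
    have n' := circle_re_sq_add_im_sq y'.1
    have m := circle_re_sq_add_im_sq y.2
    have hdet : (y.2 : ℂ).im * ((y.1 : ℂ).re * (y'.1 : ℂ).im - (y.1 : ℂ).im * (y'.1 : ℂ).re) = 0 := by
      linear_combination (y'.1 : ℂ).im * h0 - (y'.1 : ℂ).re * h3
    apply Quotient.sound
    by_cases hs : (y.2 : ℂ).im = 0
    · refine Or.inr ⟨(hsq _).2 hs, (hsq _).2 ?_⟩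
      by_contra hs'
      rw [hs] at h0 h3 m
      have ha : a = 0 := by
        refine (mul_eq_zero.1 (?_ : a * (y'.2 : ℂ).im = 0)).resolve_right hs'
        linear_combination -(y'.1 : ℂ).re * h0 - (y'.1 : ℂ).im * h3 - a * (y'.2 : ℂ).im * n'
      have ha' : a' = 0 := by
        by_contra ha'
        have hx : (y'.1 : ℂ).re = 0 := by simpa [ha', hs'] using k0
        have hz : (y'.1 : ℂ).im = 0 := by simpa [ha', hs'] using k3
        simp [hx, hz] at n'
      subst ha ha'
      have ht : (y.2 : ℂ).re = 0 := by
        linear_combination (y.1 : ℂ).re * h2 - (y.1 : ℂ).im * h1 - (y.2 : ℂ).re * n +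
          b * (y'.1 : ℂ).im * k1 - b * (y'.1 : ℂ).re * k2
      simp [ht] at m
    · refine Or.inl ?_
      have hd := (mul_eq_zero.1 hdet).resolve_left hs
      refine Prod.ext ((circle_sq_eq_sq_iff _ _).2 ?_) ((circle_sq_eq_sq_iff _ _).2 (by linarith))
      -- `(s, t) = ± a (s', t')`, where the sign `ε` is the inner product of the unit vectors
      have hε : ((y.1 : ℂ).re * (y'.1 : ℂ).re + (y.1 : ℂ).im * (y'.1 : ℂ).im) ^ 2 = 1 := by
        linear_combination ((y'.1 : ℂ).re ^ 2 + (y'.1 : ℂ).im ^ 2) * n + n' -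
          ((y.1 : ℂ).re * (y'.1 : ℂ).im - (y.1 : ℂ).im * (y'.1 : ℂ).re) * hd
      have hε0 : (y.1 : ℂ).re * (y'.1 : ℂ).re + (y.1 : ℂ).im * (y'.1 : ℂ).im ≠ 0 := by
        intro h
        simp [h] at hε
      have e1 : (y.2 : ℂ).im * ((y.1 : ℂ).re * (y'.1 : ℂ).re + (y.1 : ℂ).im * (y'.1 : ℂ).im) =
          a * (y'.2 : ℂ).im := by
        linear_combination (y'.1 : ℂ).re * h0 + (y'.1 : ℂ).im * h3 + a * (y'.2 : ℂ).im * n'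
      have e2 : (y.2 : ℂ).re * ((y.1 : ℂ).re * (y'.1 : ℂ).re + (y.1 : ℂ).im * (y'.1 : ℂ).im) =
          a * (y'.2 : ℂ).re := by
        linear_combination (y'.1 : ℂ).re * h2 - (y'.1 : ℂ).im * h1 + a * (y'.2 : ℂ).re * n'
      refine mul_left_cancel₀ hε0 ?_
      linear_combination (y'.2 : ℂ).im * e2 - (y'.2 : ℂ).re * e1

/-! ### Integral elements of hyperbolic, parabolic and elliptic points -/

theorem IsHyperbolic.nonempty_homeomorph {F : Jet2 → ℝ} {w : eqn F} (hw : SymbolNeZero F w)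
    (h : IsHyperbolic F w) : Nonempty (fibre F w ≃ₜ Torus) := by
  obtain ⟨e, k, hek, he, hb, hk⟩ := h.exists_basis
  obtain ⟨Ψ⟩ := nonempty_adaptedCoords hw e k hek
  rw [he, hk] at Ψ
  exact (Ψ.nonempty_homeomorph_torus hb).map (fibreHomeomorph F w).trans

theorem IsParabolic.nonempty_homeomorph {F : Jet2 → ℝ} {w : eqn F}
    (h : IsParabolic F w) : Nonempty (fibre F w ≃ₜ PinchedTorus) := by
  obtain ⟨e, k, hek, he, hb, hk⟩ := h.exists_basis
  obtain ⟨Ψ⟩ := nonempty_adaptedCoords h.1 e k hek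
  rw [he, hb] at Ψ
  exact (Ψ.nonempty_homeomorph_pinchedTorus hk).map (fibreHomeomorph F w).trans

theorem IsElliptic.nonempty_homeomorph {F : Jet2 → ℝ} {w : eqn F} (hw : SymbolNeZero F w)
    (h : IsElliptic F w) : Nonempty (fibre F w ≃ₜ Sphere2) := by
  obtain ⟨e, k, hek, he, hb, hk⟩ := h.exists_basis
  obtain ⟨Ψ⟩ := nonempty_adaptedCoords hw e k hek
  rw [hb, hk] at Ψ
  exact (Ψ.nonempty_homeomorph_sphere he).map (fibreHomeomorph F w).trans

end SecondOrderPDE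

end

theorem mainTheorem1 (F : SecondOrderPDE.Jet2 → ℝ) (hF : SecondOrderPDE.IsRegularPDE F)
    (w : SecondOrderPDE.eqn F) :
    (SecondOrderPDE.IsHyperbolic F w ↔
      Nonempty (SecondOrderPDE.fibre F w ≃ₜ SecondOrderPDE.Torus)) ∧
    (SecondOrderPDE.IsParabolic F w ↔
      Nonempty (SecondOrderPDE.fibre F w ≃ₜ SecondOrderPDE.PinchedTorus)) ∧
    (SecondOrderPDE.IsElliptic F w ↔
      Nonempty (SecondOrderPDE.fibre F w ≃ₜ SecondOrderPDE.Sphere2)) ∧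
    Module.finrank ℝ (SecondOrderPDE.distribution F w) = 4 ∧
    SecondOrderPDE.Prolongation.plane '' SecondOrderPDE.fibre F w =
      {v : SecondOrderPDE.Gr 2 SecondOrderPDE.Jet2 |
        v.1 ≤ SecondOrderPDE.distribution F w ∧
        SecondOrderPDE.ExtDerivVanishes (SecondOrderPDE.contactForm 1) w v.1 ∧
        SecondOrderPDE.ExtDerivVanishes (SecondOrderPDE.contactForm 2) w v.1} := by
  have hw : SecondOrderPDE.SymbolNeZero F w := hF.regular w w.2
  have hTP := SecondOrderPDE.isEmpty_torus_homeomorph_pinchedTorus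
  have hSP := SecondOrderPDE.isEmpty_sphere_homeomorph_pinchedTorus
  have hTS := SecondOrderPDE.isEmpty_torus_homeomorph_sphere
  have key : (SecondOrderPDE.IsHyperbolic F w ↔
      Nonempty (SecondOrderPDE.fibre F w ≃ₜ SecondOrderPDE.Torus)) ∧
    (SecondOrderPDE.IsParabolic F w ↔
      Nonempty (SecondOrderPDE.fibre F w ≃ₜ SecondOrderPDE.PinchedTorus)) ∧
    (SecondOrderPDE.IsElliptic F w ↔
      Nonempty (SecondOrderPDE.fibre F w ≃ₜ SecondOrderPDE.Sphere2)) := by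
    -- exactly one of the three types occurs, and the three surfaces are not homeomorphic
    rcases lt_trichotomy (SecondOrderPDE.discriminant F w) 0 with h | h | h
    · obtain ⟨e⟩ := SecondOrderPDE.IsHyperbolic.nonempty_homeomorph hw h
      exact ⟨iff_of_true h ⟨e⟩,
        iff_of_false (fun h' => h.ne h'.2) fun ⟨e'⟩ => hTP.false (e.symm.trans e'),
        iff_of_false (fun h' => h.not_gt h') fun ⟨e'⟩ => hTS.false (e.symm.trans e')⟩
    · have hp : SecondOrderPDE.IsParabolic F w := ⟨hw, h⟩
      obtain ⟨e⟩ := hp.nonempty_homeomorph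
      exact ⟨iff_of_false (fun h' => h'.ne h) fun ⟨e'⟩ => hTP.false (e'.symm.trans e),
        iff_of_true hp ⟨e⟩,
        iff_of_false (fun h' => h'.ne' h) fun ⟨e'⟩ => hSP.false (e'.symm.trans e)⟩
    · obtain ⟨e⟩ := SecondOrderPDE.IsElliptic.nonempty_homeomorph hw h
      exact ⟨iff_of_false (fun h' => h.not_gt h') fun ⟨e'⟩ => hTS.false (e'.symm.trans e),
        iff_of_false (fun h' => h.ne' h'.2) fun ⟨e'⟩ => hSP.false (e.symm.trans e'),
        iff_of_true h ⟨e⟩⟩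
  exact ⟨key.1, key.2.1, key.2.2, SecondOrderPDE.finrank_distribution hw,
    SecondOrderPDE.plane_image_fibre F w⟩
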